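/- **Conventions.** Let $k$ be a field. For a Lie algebra $L$ over $k$ write $L^2=[L,L]$ and $Z(L)$ for its centre, and let $A(n)$ be the abelian Lie algebra of dimension $n$. A Lie algebra $H$ is *generalized Heisenberg of rank $m$* if $H^2=Z(H)$ and $\dim H^2=m$. The Schur multiplier is $\mathcal M(L)=(R\cap F^2)/[R,F]$, where $0\to R\to F\to L\to 0$ is any presentation with $F$ a free Lie algebra. The non-abelian tensor square $L\otimes L$ is the Lie algebra generated by symbols $x\otimes y$ ($x,y\in L$), bilinear in $x$ and $y$, subject to $$[x,x']\otimes y=x\otimes[x',y]-x'\otimes[x,y],\quad x\otimes[y,y']=[y',x]\otimes y-[y,x]\otimes y',\quad [x\otimes y,x'\otimes y']=-[y,x]\otimes[x',y'].$$ The exterior square $L\wedge L$ is the quotient of $L\otimes L$ by the ideal generated by all $x\otimes x$, and $J_2(L)$ is the kernel of the commutator map $L\otimes L\to L^2$, $x\otimes y\mapsto[x,y]$. **Theorem.** Let $L$ be a finite-dimensional nilpotent Lie algebra of class two over $k$ with $\dim L/Z(L)=d$. Then $L\cong H\oplus A(t)$ for some $t\ge 0$ and some generalized Heisenberg Lie algebra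 $H$ of rank $\dim L^2$ with $\dim H/H^2=d$. For every decomposition $L\cong H\oplus A(t)$ with $H$ generalized Heisenberg the following hold. (i) If $\dim L^2=\frac12d(d-1)-1$, then $$\begin{aligned} \mathcal M(L)&\cong A\big(\tfrac13d(d-1)(d+1)+\tfrac12(t-1)(t+2d)+1\big),\\ L\wedge L&\cong A\big(\tfrac16(d-1)(2d^2+5d-6)+\tfrac12t(t-1)+dt-1\big),\\ L\otimes L&\cong A\big(\tfrac13d(d^2+3d-4)+\tfrac12(2t^2+4dt)\big),\\ J_2(L)&\cong A\big(\tfrac13d(d-1)(d+1)+\tfrac12(2t^2+4dt+d^2-d)+1\big). \end{aligned}$$ (ii) If $\dim L^2=\frac12d(d-1)-2$, then $$\begin{aligned} \mathcal M(L)&\cong A\big(\tfrac13d(d-1)(d+1)+\tfrac12(t-1)(t+2d)-d+2\big),\\ L\wedge L&\cong A\big(\tfrac16(d-1)(2d^2+5d-12)+\tfrac12t(t-1)+dt-2\big),\\ L\otimes L&\cong A\big(\tfrac13d(d^2+3d-7)+\tfrac12(2t^2+4dt)\big),\\ J_2(L)&\cong A\big(\tfrac13d(d-1)(d+1)+\tfrac12(2t^2+4dt+d^2-3d)+2\big).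 \end{aligned}$$ (iii) If $\dim L^2=\frac12d(d-1)-3$, then either $$\begin{aligned} \mathcal M(L)&\cong A\big(\tfrac13d(d-1)(d+1)+\tfrac12(t-1)(t+2d)-2d+3\big),\\ L\wedge L&\cong A\big(\tfrac16(d-1)(2d^2+5d-18)+\tfrac12t(t-1)+dt-3\big),\\ L\otimes L&\cong A\big(\tfrac13d(d^2+3d-10)+\tfrac12(2t^2+4dt)\big),\\ J_2(L)&\cong A\big(\tfrac13d(d-1)(d+1)+\tfrac12(2t^2+4dt+d^2-5d)+3\big), \end{aligned}$$ or $$\begin{aligned} \mathcal M(L)&\cong A\big(\tfrac13d(d-1)(d+1)+\tfrac12(t-1)(t+2d)-2d+4\big),\\ L\wedge L&\cong A\big(\tfrac16(d-1)(2d^2+5d-18)+\tfrac12t(t-1)+dt-2\big),\\ L\otimes L&\cong A\big(\tfrac13d(d^2+3d-10)+\tfrac12(2t^2+4dt)+1\big),\\ J_2(L)&\cong A\big(\tfrac13d(d-1)(d+1)+\tfrac12(2t^2+4dt+d^2-5d)+4\big). \end{aligned}$$ -/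

import Mathlib

/-! Lie algebras over a commutative ring `R`: abelian Lie algebras `A(n)`, the Schur multiplier of a
free presentation, the non-abelian tensor and exterior squares, and the kernel `J₂`. -/

universe u v w

noncomputable section

/-- The derived subalgebra `L² = [L, L]`, as an ideal. -/
abbrev derivedIdeal (R : Type u) (L : Type v) [CommRing R] [LieRing L] [LieAlgebra R L] :
    LieIdeal R L :=
  ⁅(⊤ : LieIdeal R L), (⊤ : LieIdeal R L)⁆

/-- A generalized Heisenberg Lie algebra of rank `n`: `H² = Z(H)` and `dim H² = n`. -/
structure IsGeneralizedHeisenberg (R : Type u) (H : Type v) [CommRing R] [LieRing H]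
    [LieAlgebra R H] (n : ℕ) : Prop where
  derived_eq_center : derivedIdeal R H = LieAlgebra.center R H
  rank_eq : Module.finrank R (derivedIdeal R H) = n

/-- The underlying space of the abelian Lie algebra `A(n)`: coordinate `n`-space. -/
def AbelianLie (R : Type u) (n : ℕ) : Type u := Fin n → R

namespace AbelianLie

variable (R : Type u) [CommRing R] (n : ℕ)

instance : AddCommGroup (AbelianLie R n) := inferInstanceAs (AddCommGroup (Fin n → R))

instance : Module R (AbelianLie R n) := inferInstanceAs (Module R (Fin n → R))

/-- The bracket of `A(n)` is zero. -/
instance : LieRing (AbelianLie R n) where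
  bracket _ _ := 0
  add_lie _ _ _ := (add_zero _).symm
  lie_add _ _ _ := (add_zero _).symm
  lie_self _ := rfl
  leibniz_lie _ _ _ := (add_zero _).symm

instance : LieAlgebra R (AbelianLie R n) where
  lie_smul _ _ _ := (smul_zero _).symm

end AbelianLie

/-- `M ≅ A(q)`, where the dimension `q`, given by a formula with rational coefficients, is
required to be a natural number. -/
def IsIsoAbelian (R : Type u) (M : Type v) [CommRing R] [LieRing M] [LieAlgebra R M]
    (q : ℚ) : Prop :=
  ∃ n : ℕ, (n : ℚ) = q ∧ Nonempty (M ≃ₗ⁅R⁆ AbelianLie R n)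

section SchurMultiplier

variable {R : Type u} {L : Type v} {X : Type w} [CommRing R] [LieRing L] [LieAlgebra R L]

/-- The ideal `K ∩ F²` of the free Lie algebra `F` on `X`, where `K = ker π`. -/
abbrev relationsInDerived (π : FreeLieAlgebra R X →ₗ⁅R⁆ L) : LieIdeal R (FreeLieAlgebra R X) :=
  π.ker ⊓ derivedIdeal R (FreeLieAlgebra R X)

/-- The Schur multiplier `(K ∩ F²) / [K, F]` computed from the free presentation `π : F → L`
(a surjective homomorphism) with kernel `K`. -/
abbrev SchurMultiplier (π : FreeLieAlgebra R X →ₗ⁅R⁆ L) : Type (max u w) :=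
  relationsInDerived π ⧸
    LieIdeal.comap (relationsInDerived π).incl
      ⁅π.ker, (⊤ : LieIdeal R (FreeLieAlgebra R X))⁆

end SchurMultiplier

section Squares

variable (R : Type u) (L : Type v) [CommRing R] [LieRing L] [LieAlgebra R L]

/-- The symbol `x ⊗ y`, as a free generator. -/
abbrev tensorSymbol (x y : L) : FreeLieAlgebra R (L × L) := FreeLieAlgebra.of R (x, y)

/-- The defining relators of the non-abelian tensor square `L ⊗ L`, with `L` acting on itself by
the adjoint action `ˣy = [x, y]`:
bilinearity, `[x, x'] ⊗ y = x ⊗ ˣ'y - x' ⊗ ˣy`, `x ⊗ [y, y'] = ʸ'x ⊗ y - ʸx ⊗ y'` and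
`[x ⊗ y, x' ⊗ y'] = -(ʸx ⊗ ˣ'y')`. -/
inductive TensorRelator : FreeLieAlgebra R (L × L) → Prop
  | smul_left (c : R) (x y : L) :
      TensorRelator (tensorSymbol R L (c • x) y - c • tensorSymbol R L x y)
  | smul_right (c : R) (x y : L) :
      TensorRelator (tensorSymbol R L x (c • y) - c • tensorSymbol R L x y)
  | add_left (x x' y : L) :
      TensorRelator
        (tensorSymbol R L (x + x') y - (tensorSymbol R L x y + tensorSymbol R L x' y))
  | add_right (x y y' : L) :
      TensorRelator
        (tensorSymbol R L x (y + y') - (tensorSymbol R L x y + tensorSymbol R L x y'))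
  | lie_left (x x' y : L) :
      TensorRelator
        (tensorSymbol R L ⁅x, x'⁆ y - (tensorSymbol R L x ⁅x', y⁆ - tensorSymbol R L x' ⁅x, y⁆))
  | lie_right (x y y' : L) :
      TensorRelator
        (tensorSymbol R L x ⁅y, y'⁆ - (tensorSymbol R L ⁅y', x⁆ y - tensorSymbol R L ⁅y, x⁆ y'))
  | lie_lie (x y x' y' : L) :
      TensorRelator
        (⁅tensorSymbol R L x y, tensorSymbol R L x' y'⁆ - -tensorSymbol R L ⁅y, x⁆ ⁅x', y'⁆)

/-- The ideal generated by the relators of the tensor square. -/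
abbrev tensorIdeal : LieIdeal R (FreeLieAlgebra R (L × L)) :=
  LieSubmodule.lieSpan R (FreeLieAlgebra R (L × L)) {a | TensorRelator R L a}

/-- The non-abelian tensor square `L ⊗ L`. -/
abbrev TensorSquare : Type (max u v) := FreeLieAlgebra R (L × L) ⧸ tensorIdeal R L

/-- The element `x ⊗ y` of `L ⊗ L`. -/
def tensorElt (x y : L) : TensorSquare R L :=
  LieSubmodule.Quotient.mk (N := tensorIdeal R L) (tensorSymbol R L x y)

/-- The ideal `L □ L` of `L ⊗ L` generated by the elements `x ⊗ x`. -/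
abbrev squareIdeal : LieIdeal R (TensorSquare R L) :=
  LieSubmodule.lieSpan R (TensorSquare R L) (Set.range fun x : L => tensorElt R L x x)

/-- The non-abelian exterior square `L ∧ L`. -/
abbrev ExteriorSquare : Type (max u v) := TensorSquare R L ⧸ squareIdeal R L

/-- The homomorphism on free generators sending the symbol `x ⊗ y` to `[x, y]`. -/
def preCommutator : FreeLieAlgebra R (L × L) →ₗ⁅R⁆ L :=
  FreeLieAlgebra.lift R fun p : L × L => ⁅p.1, p.2⁆

theorem preCommutator_symbol (x y : L) :
    preCommutator R L (tensorSymbol R L x y) = ⁅x, y⁆ :=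
  FreeLieAlgebra.lift_of_apply _ _

theorem tensorIdeal_le_ker : tensorIdeal R L ≤ (preCommutator R L).ker := by
  rw [LieSubmodule.lieSpan_le]
  intro a ha
  rw [SetLike.mem_coe, LieHom.mem_ker]
  induction ha with
  | smul_left c x y => simp only [map_sub, map_smul, preCommutator_symbol, smul_lie, sub_self]
  | smul_right c x y => simp only [map_sub, map_smul, preCommutator_symbol, lie_smul, sub_self]
  | add_left x x' y => simp only [map_sub, map_add, preCommutator_symbol, add_lie, sub_self]
  | add_right x y y' => simp only [map_sub, map_add, preCommutator_symbol, lie_add, sub_self]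
  | lie_left x x' y => simp only [map_sub, preCommutator_symbol, lie_lie, sub_self]
  | lie_right x y y' =>
    simp only [map_sub, preCommutator_symbol]
    rw [← lie_skew y' x, ← lie_skew y x, leibniz_lie x y y', neg_lie, neg_lie,
      ← lie_skew y ⁅x, y'⁆]
    abel
  | lie_lie x y x' y' =>
    simp only [map_sub, map_neg, LieHom.map_lie, preCommutator_symbol]
    rw [← lie_skew y x, neg_lie, neg_neg, sub_self]

/-- The commutator map `κ : L ⊗ L → L`, `x ⊗ y ↦ [x, y]`, whose image is `L²`. -/
def commutatorMap : TensorSquare R L →ₗ⁅R⁆ L :=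
  { (tensorIdeal R L).toSubmodule.liftQ (preCommutator R L : FreeLieAlgebra R (L × L) →ₗ[R] L)
      (fun _ ha => tensorIdeal_le_ker R L ha) with
    map_lie' := by
      intro a b
      induction a using Submodule.Quotient.induction_on with
      | H a =>
        induction b using Submodule.Quotient.induction_on with
        | H b => exact LieHom.map_lie (preCommutator R L) a b }

theorem commutatorMap_tensorElt (x y : L) : commutatorMap R L (tensorElt R L x y) = ⁅x, y⁆ :=
  preCommutator_symbol R L x y

/-- `J₂(L)`, the kernel of the commutator map `κ`. -/
abbrev JTwo : LieIdeal R (TensorSquare R L) := (commutatorMap R L).ker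

end Squares

end

/-!
Write `V = L / L²` and `W = L / Z(L)`, of dimensions `n = d + t` and `d`, and `m = dim L²`. The
bracket is a surjective linear map `B : ⋀² W → L²`. Let `Q` be the cokernel of the Jacobi map
`⋀³ W → W ⊗ L²`, `a ∧ b ∧ c ↦ a ⊗ B(b, c) + b ⊗ B(c, a) + c ⊗ B(a, b)`. In class two the defining
relations give linear isomorphisms `L ⊗ L ≅ (V ⊗ V) × Q` and `L ∧ L ≅ ⋀² V × Q`, valid in every
characteristic (`exists_square_equivs`): elements `a ⊗ z` with `a ∈ L²`, `z ∈ Z(L)` vanish,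
`x ⊗ a = -(a ⊗ x)` for `a ∈ L²`, and the elements `[a, b] ⊗ c` satisfy the Jacobi identity and
nothing more. All these Lie algebras are abelian.

The Schur multiplier of any free presentation is the kernel of `L ∧ L → L`
(`schurMultiplier_equiv`). The pairing `(x, y) ↦ x ∧ y` is a 2-cocycle, and lifting the
presentation `π : F → L` to the central extension it defines yields a linear map `θ` on `F` with
`θ [f, g] = π f ∧ π g`; conversely `π f ∧ π g ↦ [f, g]` is well defined modulo `[ker π, F]`, and the
two maps are inverse to each other on `F² / [ker π, F]`.

So all four dimensions are determined by `n`, `m` and `dim Q`, and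
`dim Q = d m - (d choose 3) + dim S` with `S` the kernel of the Jacobi map. The contractions of
`ω ∈ S` with linear forms lie in `ker B`, whose dimension is `1`, `2` or `3` in the three cases. If
`ω ≠ 0`, say `ω(f₀, f₁, f₂) ≠ 0`, its contractions with the `fᵢ` are linearly independent. Hence
`S = 0` if `dim ker B ≤ 2` (`ker_jacobiMap_eq_bot`). If `dim ker B = 3`, the radical of such an `ω`
is the common radical of the relations, of codimension three, so that `dim S ≤ 1`
(`finrank_ker_jacobiMap_le_one`); the two values give the two alternatives of the last case.
-/

/-! ### Trivectors and the Jacobi map of an alternating bilinear map -/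

noncomputable section JacobiMap

open scoped TensorProduct
open Module

variable {K : Type*} [Field K] {W : Type*} [AddCommGroup W] [Module K W]
  {D : Type*} [AddCommGroup D] [Module K D]

/-- The product `(a, b) ↦ a ∧ b`, as a bilinear map into the second exterior power. -/
def wedgeTwo (K : Type*) [Field K] (W : Type*) [AddCommGroup W] [Module K W] :
    W →ₗ[K] W →ₗ[K] ⋀[K]^2 W :=
  LinearMap.mk₂ K (fun a b => (((exteriorPower.ιMulti K 2).curryLeft a).curryLeft b) ![])
    (by intros; simp) (by intros; simp) (by intros; simp) (by intros; simp)

theorem wedgeTwo_apply (a b : W) : wedgeTwo K W a b = exteriorPower.ιMulti K 2 ![a, b] := rfl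

theorem wedgeTwo_self (a : W) : wedgeTwo K W a a = 0 :=
  (exteriorPower.ιMulti K 2).map_eq_zero_of_eq ![a, a] (i := 0) (j := 1) rfl (by decide)

/-- Two linear maps on the second exterior power agree if they agree on all `a ∧ b`. -/
theorem wedgeTwo_ext {N : Type*} [AddCommGroup N] [Module K N] {f g : ⋀[K]^2 W →ₗ[K] N}
    (h : ∀ a b, f (wedgeTwo K W a b) = g (wedgeTwo K W a b)) : f = g := by
  refine exteriorPower.linearMap_ext (AlternatingMap.ext fun v => ?_)
  have hv : v = ![v 0, v 1] := by ext i; fin_cases i <;> rfl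
  rw [hv]
  exact h _ _

/-- The linear map on the second exterior power defined by an alternating bilinear map. -/
def liftWedgeTwo {N : Type*} [AddCommGroup N] [Module K N] (c : W →ₗ[K] W →ₗ[K] N)
    (hc : ∀ a, c a a = 0) : ⋀[K]^2 W →ₗ[K] N :=
  exteriorPower.alternatingMapLinearEquiv
    { toFun := fun v => c (v 0) (v 1)
      map_update_add' := by
        intro _ v i x y
        fin_cases i <;> simp [Function.update]
      map_update_smul' := by
        intro _ v i r x
        fin_cases i <;> simp [Function.update]
      map_eq_zero_of_eq' := by
        intro v i j hij hne
        have h01 : v 0 = v 1 := by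
          fin_cases i <;> fin_cases j <;> first | exact absurd rfl hne | exact hij | exact hij.symm
        change c (v 0) (v 1) = 0
        rw [h01, hc] }

theorem liftWedgeTwo_apply {N : Type*} [AddCommGroup N] [Module K N] (c : W →ₗ[K] W →ₗ[K] N)
    (hc : ∀ a, c a a = 0) (a b : W) : liftWedgeTwo c hc (wedgeTwo K W a b) = c a b := by
  rw [wedgeTwo_apply, liftWedgeTwo, exteriorPower.alternatingMapLinearEquiv_apply_ιMulti]
  rfl

/-- The alternating trilinear map `(a, b, c) ↦ a ⊗ β(b, c) + b ⊗ β(c, a) + c ⊗ β(a, b)` of an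
alternating bilinear map `β`. -/
def cyclicSum {N : Type*} [AddCommGroup N] [Module K N] (β : W →ₗ[K] W →ₗ[K] N)
    (hβ : ∀ a, β a a = 0) : W [⋀^Fin 3]→ₗ[K] W ⊗[K] N where
  toFun v := v 0 ⊗ₜ β (v 1) (v 2) + v 1 ⊗ₜ β (v 2) (v 0) + v 2 ⊗ₜ β (v 0) (v 1)
  map_update_add' := by
    intro inst v i x y
    obtain rfl : inst = instDecidableEqFin 3 := Subsingleton.elim _ _
    fin_cases i <;> simp [Function.update, TensorProduct.add_tmul, TensorProduct.tmul_add] <;>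
      abel
  map_update_smul' := by
    intro inst v i r x
    obtain rfl : inst = instDecidableEqFin 3 := Subsingleton.elim _ _
    fin_cases i <;> simp [Function.update, TensorProduct.smul_tmul']
  map_eq_zero_of_eq' := by
    intro v i j hij hne
    have hskew : ∀ a b : W, a ⊗ₜ[K] β a b + a ⊗ₜ[K] β b a = 0 := by
      intro a b
      have h := hβ (a + b)
      simp only [map_add, LinearMap.add_apply, hβ, zero_add, add_zero] at h
      rw [← TensorProduct.tmul_add, add_comm, h, TensorProduct.tmul_zero]
    have h : v 0 = v 1 ∨ v 0 = v 2 ∨ v 1 = v 2 := by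
      fin_cases i <;> fin_cases j <;> simp_all
    have hskew' : ∀ a b : W, a ⊗ₜ[K] β b a + a ⊗ₜ[K] β a b = 0 := fun a b => by
      rw [add_comm, hskew]
    rcases h with h | h | h <;>
      simp only [h, hβ, TensorProduct.tmul_zero, add_zero, zero_add, hskew, hskew']

/-- The component `⋀³ W → W ⊗ ⋀² W` of the comultiplication of the exterior algebra,
`a ∧ b ∧ c ↦ a ⊗ (b ∧ c) + b ⊗ (c ∧ a) + c ⊗ (a ∧ b)`. -/
def wedgeComul (K : Type*) [Field K] (W : Type*) [AddCommGroup W] [Module K W] :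
    ⋀[K]^3 W →ₗ[K] W ⊗[K] ⋀[K]^2 W :=
  exteriorPower.alternatingMapLinearEquiv (cyclicSum (wedgeTwo K W) wedgeTwo_self)

theorem wedgeComul_apply (v : Fin 3 → W) :
    wedgeComul K W (exteriorPower.ιMulti K 3 v) =
      v 0 ⊗ₜ wedgeTwo K W (v 1) (v 2) + v 1 ⊗ₜ wedgeTwo K W (v 2) (v 0)
        + v 2 ⊗ₜ wedgeTwo K W (v 0) (v 1) :=
  exteriorPower.alternatingMapLinearEquiv_apply_ιMulti _ _

/-- The contraction `(f, ω) ↦ f ⌟ ω` of a trivector with a linear form. -/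
def contract : Dual K W →ₗ[K] ⋀[K]^3 W →ₗ[K] ⋀[K]^2 W :=
  LinearMap.mk₂ K (fun f ω => TensorProduct.lid K _ (f.rTensor (⋀[K]^2 W) (wedgeComul K W ω)))
    (by intro f g ω; simp [LinearMap.rTensor_add])
    (by intro r f ω; simp [LinearMap.rTensor_smul])
    (by intro f ω ω'; simp) (by intro r f ω; simp)

theorem contract_apply (f : Dual K W) (ω : ⋀[K]^3 W) :
    contract f ω = TensorProduct.lid K _ (f.rTensor (⋀[K]^2 W) (wedgeComul K W ω)) := rfl

theorem pairingDual_contract (f g h : Dual K W) (ω : ⋀[K]^3 W) :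
    exteriorPower.pairingDual K W 2 (exteriorPower.ιMulti K 2 ![g, h]) (contract f ω) =
      exteriorPower.pairingDual K W 3 (exteriorPower.ιMulti K 3 ![f, g, h]) ω := by
  suffices H : (exteriorPower.pairingDual K W 2 (exteriorPower.ιMulti K 2 ![g, h])) ∘ₗ contract f =
      exteriorPower.pairingDual K W 3 (exteriorPower.ιMulti K 3 ![f, g, h]) from
    LinearMap.congr_fun H ω
  refine exteriorPower.linearMap_ext (AlternatingMap.ext fun v => ?_)
  simp only [LinearMap.compAlternatingMap_apply, LinearMap.comp_apply, contract_apply,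
    wedgeComul_apply, map_add, LinearMap.rTensor_tmul, TensorProduct.lid_tmul, map_smul,
    wedgeTwo_apply, exteriorPower.pairingDual_ιMulti_ιMulti, Matrix.det_fin_two,
    Matrix.det_fin_three]
  simp
  ring

/-- The value of a trivector `ω` on three linear forms. -/
def trivectorForm (ω : ⋀[K]^3 W) (f g h : Dual K W) : K :=
  exteriorPower.pairingDual K W 3 (exteriorPower.ιMulti K 3 ![f, g, h]) ω

theorem trivectorForm_eq (ω : ⋀[K]^3 W) (f g h : Dual K W) : trivectorForm ω f g h =
    exteriorPower.pairingDual K W 2 (exteriorPower.ιMulti K 2 ![g, h]) (contract f ω) :=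
  (pairingDual_contract f g h ω).symm

theorem trivectorForm_self_left (ω : ⋀[K]^3 W) (f h : Dual K W) : trivectorForm ω f f h = 0 := by
  rw [trivectorForm, (exteriorPower.ιMulti K 3).map_eq_zero_of_eq ![f, f, h] (i := 0) (j := 1) rfl
    (by decide), map_zero, LinearMap.zero_apply]

theorem trivectorForm_self_outer (ω : ⋀[K]^3 W) (f h : Dual K W) : trivectorForm ω f h f = 0 := by
  rw [trivectorForm, (exteriorPower.ιMulti K 3).map_eq_zero_of_eq ![f, h, f] (i := 0) (j := 2) rfl
    (by decide), map_zero, LinearMap.zero_apply]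

theorem trivectorForm_swap_left (ω : ⋀[K]^3 W) (f g h : Dual K W) :
    trivectorForm ω f g h = - trivectorForm ω g f h := by
  have h1 := (exteriorPower.ιMulti (M := Dual K W) K 3).map_swap ![f, g, h] (i := 0) (j := 1)
    (by decide)
  have h2 : ![f, g, h] ∘ (Equiv.swap (0 : Fin 3) 1) = ![g, f, h] := by
    ext i; fin_cases i <;> rfl
  rw [h2] at h1
  rw [trivectorForm, trivectorForm, h1, map_neg, LinearMap.neg_apply, neg_neg]

theorem trivectorForm_swap_right (ω : ⋀[K]^3 W) (f g h : Dual K W) :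
    trivectorForm ω f g h = - trivectorForm ω f h g := by
  have h1 := (exteriorPower.ιMulti (M := Dual K W) K 3).map_swap ![f, g, h] (i := 1) (j := 2)
    (by decide)
  have h2 : ![f, g, h] ∘ (Equiv.swap (1 : Fin 3) 2) = ![f, h, g] := by
    ext i; fin_cases i <;> rfl
  rw [h2] at h1
  rw [trivectorForm, trivectorForm, h1, map_neg, LinearMap.neg_apply, neg_neg]

/-- A trivector vanishing on all triples of linear forms is zero: these values contain its
coordinates in a basis of `⋀³ W`. -/
theorem eq_zero_of_trivectorForm_eq_zero (ω : ⋀[K]^3 W)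
    (h : ∀ f g h, trivectorForm ω f g h = 0) : ω = 0 := by
  classical
  obtain ⟨I, b⟩ := Module.Free.exists_basis K W
  let : LinearOrder I := linearOrderOfSTO WellOrderingRel
  refine (b.exteriorPower 3).ext_elem fun s => ?_
  rw [exteriorPower.basis_repr_apply, map_zero, Finsupp.zero_apply, exteriorPower.ιMultiDual,
    exteriorPower.ιMulti_family]
  generalize b.coord ∘ _ = v
  have hv : v = ![v 0, v 1, v 2] := by ext i; fin_cases i <;> rfl
  rw [hv]
  exact h _ _ _

theorem exists_sum_eq_of_finrank_eq_three {M : Type*} [AddCommGroup M] [Module K M]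
    {U : Submodule K M} (hU : finrank K U = 3) {v : Fin 3 → M} (hv : ∀ i, v i ∈ U)
    (hli : LinearIndependent K v) {x : M} (hx : x ∈ U) : ∃ a : Fin 3 → K, ∑ i, a i • v i = x := by
  have hfin : FiniteDimensional K U := FiniteDimensional.of_finrank_pos (by omega)
  have hle : Submodule.span K (Set.range v) ≤ U :=
    Submodule.span_le.2 (Set.range_subset_iff.2 hv)
  have heq : Submodule.span K (Set.range v) = U :=
    Submodule.eq_of_le_of_finrank_eq hle (by rw [finrank_span_eq_card hli, hU]; rfl)
  exact (Submodule.mem_span_range_iff_exists_fun K).1 (heq ▸ hx)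

variable (B : ⋀[K]^2 W →ₗ[K] D)

/-- The Jacobi map `a ∧ b ∧ c ↦ a ⊗ B(b, c) + b ⊗ B(c, a) + c ⊗ B(a, b)` of an alternating
bilinear map `B`. -/
def jacobiMap : ⋀[K]^3 W →ₗ[K] W ⊗[K] D := B.lTensor W ∘ₗ wedgeComul K W

theorem jacobiMap_apply (v : Fin 3 → W) :
    jacobiMap B (exteriorPower.ιMulti K 3 v) =
      v 0 ⊗ₜ B (wedgeTwo K W (v 1) (v 2)) + v 1 ⊗ₜ B (wedgeTwo K W (v 2) (v 0))
        + v 2 ⊗ₜ B (wedgeTwo K W (v 0) (v 1)) := by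
  simp [jacobiMap, wedgeComul_apply]

theorem contract_mem_ker {ω : ⋀[K]^3 W} (hω : ω ∈ (jacobiMap B).ker) (f : Dual K W) :
    contract f ω ∈ B.ker := by
  have h : ∀ z : W ⊗[K] ⋀[K]^2 W, B (TensorProduct.lid K _ (f.rTensor (⋀[K]^2 W) z)) =
      TensorProduct.lid K _ (f.rTensor D (B.lTensor W z)) := by
    intro z
    induction z with
    | zero => simp
    | tmul x y => simp
    | add x y hx hy => simp only [map_add, hx, hy]
  rw [LinearMap.mem_ker, contract_apply, h]
  rw [LinearMap.mem_ker, jacobiMap, LinearMap.comp_apply] at hω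
  rw [hω, map_zero, map_zero]

/-- If `ω` does not vanish on `f 0, f 1, f 2`, its contractions with these forms are linearly
independent: pair a relation with the product of two of the forms. -/
theorem linearIndependent_contract {ω : ⋀[K]^3 W} {f : Fin 3 → Dual K W}
    (h : trivectorForm ω (f 0) (f 1) (f 2) ≠ 0) :
    LinearIndependent K fun i => contract (f i) ω := by
  rw [Fintype.linearIndependent_iff]
  intro a ha
  have key : ∀ g h, a 0 * trivectorForm ω (f 0) g h + a 1 * trivectorForm ω (f 1) g h +
      a 2 * trivectorForm ω (f 2) g h = 0 := by
    intro g h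
    have := congrArg (exteriorPower.pairingDual K W 2 (exteriorPower.ιMulti K 2 ![g, h])) ha
    simpa only [Fin.sum_univ_three, map_add, map_smul, ← trivectorForm_eq, smul_eq_mul, map_zero]
      using this
  have h0 := key (f 1) (f 2)
  have h1 := key (f 0) (f 2)
  have h2 := key (f 0) (f 1)
  simp only [trivectorForm_self_left, trivectorForm_self_outer, mul_zero, add_zero,
    zero_add] at h0 h1 h2
  rw [trivectorForm_swap_left] at h1
  rw [trivectorForm_swap_left, trivectorForm_swap_right] at h2
  intro i
  fin_cases i <;> simp_all

theorem exists_trivectorForm_ne_zero {ω : ⋀[K]^3 W} (hω : ω ≠ 0) :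
    ∃ f : Fin 3 → Dual K W, trivectorForm ω (f 0) (f 1) (f 2) ≠ 0 := by
  by_contra! hcon
  exact hω (eq_zero_of_trivectorForm_eq_zero ω fun f g h => hcon ![f, g, h])

theorem linearIndependent_contract_ker {ω : ⋀[K]^3 W} (hω : ω ∈ (jacobiMap B).ker)
    {f : Fin 3 → Dual K W} (h : trivectorForm ω (f 0) (f 1) (f 2) ≠ 0) :
    LinearIndependent K fun i => (⟨contract (f i) ω, contract_mem_ker B hω (f i)⟩ : B.ker) :=
  LinearIndependent.of_comp B.ker.subtype (linearIndependent_contract h)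

/-- Suppose that `B` has exactly three independent relations and that `ω₀ ≠ 0` is killed by the
Jacobi map. The contractions of `ω₀` with suitable forms `f 0, f 1, f 2` then form a basis of the
relations, and any `ω` killed by the Jacobi map is determined by its value on `f`. -/
theorem eq_zero_of_trivectorForm_eq_zero_of_finrank_eq_three (hB : finrank K B.ker = 3)
    {ω₀ ω : ⋀[K]^3 W} (hω₀ : ω₀ ∈ (jacobiMap B).ker) (hω : ω ∈ (jacobiMap B).ker)
    {f : Fin 3 → Dual K W} (hf : trivectorForm ω₀ (f 0) (f 1) (f 2) ≠ 0)
    (h : trivectorForm ω (f 0) (f 1) (f 2) = 0) : ω = 0 := by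
  have hspan : ∀ κ ∈ B.ker, ∃ a : Fin 3 → K, ∑ i, a i • contract (f i) ω₀ = κ := fun κ hκ =>
    exists_sum_eq_of_finrank_eq_three hB (fun i => contract_mem_ker B hω₀ (f i))
      (linearIndependent_contract hf) hκ
  have hexp : ∀ x, ∃ a : Fin 3 → K, ∀ g h,
      trivectorForm ω x g h = a 0 * trivectorForm ω₀ (f 0) g h +
        a 1 * trivectorForm ω₀ (f 1) g h + a 2 * trivectorForm ω₀ (f 2) g h := by
    intro x
    obtain ⟨a, ha⟩ := hspan _ (contract_mem_ker B hω x)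
    refine ⟨a, fun g h => ?_⟩
    rw [trivectorForm_eq, ← ha]
    simp only [Fin.sum_univ_three, map_add, map_smul, ← trivectorForm_eq, smul_eq_mul]
  -- The radical of `ω₀` is contained in the radical of every relation, hence in that of `ω`.
  have hrad : ∀ n, contract n ω₀ = 0 → ∀ y z, trivectorForm ω n y z = 0 := by
    intro n hn y z
    obtain ⟨a, ha⟩ := hexp y
    have h0 : ∀ i, trivectorForm ω₀ (f i) n z = 0 := by
      intro i
      rw [trivectorForm_swap_left, trivectorForm_eq, hn, map_zero, neg_zero]
    rw [trivectorForm_swap_left, ha, h0, h0, h0]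
    simp
  -- As `ω` vanishes on `f`, all coefficients of its contractions with the `f i` are zero.
  have hcoef : ∀ i, ∀ y z, trivectorForm ω (f i) y z = 0 := by
    intro i y z
    obtain ⟨a, ha⟩ := hexp (f i)
    have h0 := ha (f 1) (f 2)
    have h1 := ha (f 0) (f 2)
    have h2 := ha (f 0) (f 1)
    have e1 : trivectorForm ω (f i) (f 1) (f 2) = 0 := by
      fin_cases i
      · exact h
      · exact trivectorForm_self_left _ _ _
      · exact trivectorForm_self_outer _ _ _
    have e2 : trivectorForm ω (f i) (f 0) (f 2) = 0 := by
      fin_cases i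
      · exact trivectorForm_self_left _ _ _
      · change trivectorForm ω (f 1) (f 0) (f 2) = 0
        rw [trivectorForm_swap_left, h, neg_zero]
      · exact trivectorForm_self_outer _ _ _
    have e3 : trivectorForm ω (f i) (f 0) (f 1) = 0 := by
      fin_cases i
      · exact trivectorForm_self_left _ _ _
      · exact trivectorForm_self_outer _ _ _
      · change trivectorForm ω (f 2) (f 0) (f 1) = 0
        rw [trivectorForm_swap_left, trivectorForm_swap_right, h, neg_zero, neg_zero]
    rw [e1] at h0
    rw [e2, trivectorForm_swap_left ω₀ (f 1)] at h1
    rw [e3, trivectorForm_swap_left ω₀ (f 2), trivectorForm_swap_right ω₀ (f 0) (f 2)] at h2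
    simp only [trivectorForm_self_left, trivectorForm_self_outer, mul_zero, add_zero,
      zero_add] at h0 h1 h2
    have a0 : a 0 = 0 := by simpa [hf] using h0.symm
    have a1 : a 1 = 0 := by simpa [hf] using h1.symm
    have a2 : a 2 = 0 := by simpa [hf] using h2.symm
    rw [ha, a0, a1, a2]
    simp
  refine eq_zero_of_trivectorForm_eq_zero ω fun x y z => ?_
  -- Every linear form is a combination of the `f i` up to an element of the radical of `ω₀`.
  obtain ⟨b, hb⟩ := hspan _ (contract_mem_ker B hω₀ x)
  have hn : contract (x - ∑ i, b i • f i) ω₀ = 0 := by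
    rw [map_sub, LinearMap.sub_apply, ← hb]
    simp
  have h1 := hrad _ hn y z
  rw [trivectorForm_eq] at h1
  have h2 : ∀ i, exteriorPower.pairingDual K W 2 (exteriorPower.ιMulti K 2 ![y, z])
      (contract (f i) ω) = 0 := fun i => by rw [← trivectorForm_eq]; exact hcoef i y z
  simp only [map_sub, LinearMap.sub_apply, map_sum, map_smul, LinearMap.smul_apply,
    LinearMap.sum_apply, h2, smul_zero, Finset.sum_const_zero, sub_zero, ← trivectorForm_eq] at h1
  exact h1

theorem finrank_ker_jacobiMap_le_one (hB : finrank K B.ker = 3) :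
    finrank K (jacobiMap B).ker ≤ 1 := by
  by_cases hbot : (jacobiMap B).ker = ⊥
  · rw [hbot, finrank_bot]; exact Nat.zero_le _
  obtain ⟨ω₀, hω₀, hne⟩ := Submodule.exists_mem_ne_zero_of_ne_bot hbot
  obtain ⟨f, hf⟩ := exists_trivectorForm_ne_zero hne
  let ev : (jacobiMap B).ker →ₗ[K] K :=
    exteriorPower.pairingDual K W 3 (exteriorPower.ιMulti K 3 ![f 0, f 1, f 2]) ∘ₗ
      (jacobiMap B).ker.subtype
  have hinj : Function.Injective ev := by
    rw [injective_iff_map_eq_zero]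
    intro ω h
    exact Subtype.ext
      (eq_zero_of_trivectorForm_eq_zero_of_finrank_eq_three B hB hω₀ ω.2 hf h)
  simpa using LinearMap.finrank_le_finrank_of_injective hinj

variable [FiniteDimensional K W]

/-- The Jacobi map is injective if `B` has at most two independent relations. -/
theorem ker_jacobiMap_eq_bot (hB : finrank K B.ker ≤ 2) : (jacobiMap B).ker = ⊥ := by
  rw [Submodule.eq_bot_iff]
  intro ω hω
  by_contra hne
  obtain ⟨f, hf⟩ := exists_trivectorForm_ne_zero hne
  have := (linearIndependent_contract_ker B hω hf).fintype_card_le_finrank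
  simp at this
  omega

variable [FiniteDimensional K D]

theorem finrank_coker_jacobiMap :
    finrank K ((W ⊗[K] D) ⧸ (jacobiMap B).range) + (finrank K W).choose 3 =
      finrank K W * finrank K D + finrank K (jacobiMap B).ker := by
  have h1 := (jacobiMap B).finrank_range_add_finrank_ker
  have h2 := (jacobiMap B).range.finrank_quotient_add_finrank
  rw [exteriorPower.finrank_eq] at h1
  rw [finrank_tensorProduct] at h2
  omega

end JacobiMap

/-! ### Tensor square, exterior square and Schur multiplier -/

noncomputable section LieGenerality

variable {R : Type*} [CommRing R] {L : Type*} [LieRing L] [LieAlgebra R L]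
  {G : Type*} [LieRing G] [LieAlgebra R G]

/-- The quotient map of a Lie algebra by an ideal, as a homomorphism of Lie algebras. -/
def lieQuotientMk (I : LieIdeal R L) : L →ₗ⁅R⁆ L ⧸ I :=
  { I.toSubmodule.mkQ with map_lie' := rfl }

theorem lieQuotientMk_eq_zero {I : LieIdeal R L} {x : L} : lieQuotientMk I x = 0 ↔ x ∈ I :=
  Submodule.Quotient.mk_eq_zero I.toSubmodule

theorem lieQuotientMk_surjective (I : LieIdeal R L) : Function.Surjective (lieQuotientMk I) :=
  Submodule.mkQ_surjective I.toSubmodule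

/-- The homomorphism from a quotient Lie algebra induced by one that vanishes on the ideal. -/
def lieQuotientLift (I : LieIdeal R L) (f : L →ₗ⁅R⁆ G) (h : I ≤ f.ker) : L ⧸ I →ₗ⁅R⁆ G :=
  { I.toSubmodule.liftQ (f : L →ₗ[R] G) (fun _ ha => h ha) with
    map_lie' := by
      intro a b
      obtain ⟨a, rfl⟩ := lieQuotientMk_surjective I a
      obtain ⟨b, rfl⟩ := lieQuotientMk_surjective I b
      exact LieHom.map_lie f a b }

theorem lieQuotientLift_mk (I : LieIdeal R L) (f : L →ₗ⁅R⁆ G) (h : I ≤ f.ker) (x : L) :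
    lieQuotientLift I f h (lieQuotientMk I x) = f x := rfl

theorem lie_mem_derivedIdeal (x y : L) : ⁅x, y⁆ ∈ derivedIdeal R L :=
  LieSubmodule.lie_mem_lie (LieSubmodule.mem_top x) (LieSubmodule.mem_top y)

theorem derivedIdeal_toSubmodule :
    (derivedIdeal R L).toSubmodule = Submodule.span R {z | ∃ x y : L, ⁅x, y⁆ = z} := by
  rw [LieSubmodule.lieIdeal_oper_eq_linear_span']
  congr 1
  ext z
  simp

theorem eq_of_mem_derivedIdeal {P : Type*} [AddCommGroup P] [Module R P] {f g : L →ₗ[R] P}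
    (h : ∀ x y : L, f ⁅x, y⁆ = g ⁅x, y⁆) {z : L} (hz : z ∈ derivedIdeal R L) : f z = g z := by
  rw [← LieSubmodule.mem_toSubmodule, derivedIdeal_toSubmodule] at hz
  refine LinearMap.eqOn_span (f := f) (g := g) ?_ hz
  rintro _ ⟨x, y, rfl⟩
  exact h x y

end LieGenerality

noncomputable section TensorSquare

variable {R : Type*} [CommRing R] {L : Type*} [LieRing L] [LieAlgebra R L]

theorem lieQuotientMk_tensorSymbol (x y : L) :
    lieQuotientMk (tensorIdeal R L) (tensorSymbol R L x y) = tensorElt R L x y := rfl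

theorem lieQuotientMk_tensorIdeal_eq {a b : FreeLieAlgebra R (L × L)}
    (h : TensorRelator R L (a - b)) :
    lieQuotientMk (tensorIdeal R L) a = lieQuotientMk (tensorIdeal R L) b := by
  rw [← sub_eq_zero, ← map_sub, lieQuotientMk_eq_zero]
  exact LieSubmodule.subset_lieSpan h

variable (R L) in
/-- The bilinear map `(x, y) ↦ x ⊗ y` into the tensor square. -/
def tensorBilin : L →ₗ[R] L →ₗ[R] TensorSquare R L :=
  LinearMap.mk₂ R (tensorElt R L)
    (fun x x' y => by
      simpa [lieQuotientMk_tensorSymbol] using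
        lieQuotientMk_tensorIdeal_eq (TensorRelator.add_left (R := R) x x' y))
    (fun c x y => by
      simpa [lieQuotientMk_tensorSymbol] using
        lieQuotientMk_tensorIdeal_eq (TensorRelator.smul_left (R := R) c x y))
    (fun x y y' => by
      simpa [lieQuotientMk_tensorSymbol] using
        lieQuotientMk_tensorIdeal_eq (TensorRelator.add_right (R := R) x y y'))
    (fun c x y => by
      simpa [lieQuotientMk_tensorSymbol] using
        lieQuotientMk_tensorIdeal_eq (TensorRelator.smul_right (R := R) c x y))

theorem tensorBilin_apply (x y : L) : tensorBilin R L x y = tensorElt R L x y := rfl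

theorem tensorBilin_lie_left (x x' y : L) : tensorBilin R L ⁅x, x'⁆ y =
    tensorBilin R L x ⁅x', y⁆ - tensorBilin R L x' ⁅x, y⁆ := by
  simpa [lieQuotientMk_tensorSymbol, tensorBilin_apply] using
    lieQuotientMk_tensorIdeal_eq (TensorRelator.lie_left (R := R) x x' y)

theorem tensorBilin_lie_right (x y y' : L) : tensorBilin R L x ⁅y, y'⁆ =
    tensorBilin R L ⁅y', x⁆ y - tensorBilin R L ⁅y, x⁆ y' := by
  simpa [lieQuotientMk_tensorSymbol, tensorBilin_apply] using
    lieQuotientMk_tensorIdeal_eq (TensorRelator.lie_right (R := R) x y y')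

theorem lie_tensorBilin (x y x' y' : L) : ⁅tensorBilin R L x y, tensorBilin R L x' y'⁆ =
    - tensorBilin R L ⁅y, x⁆ ⁅x', y'⁆ := by
  simpa [lieQuotientMk_tensorSymbol, tensorBilin_apply] using
    lieQuotientMk_tensorIdeal_eq (TensorRelator.lie_lie (R := R) x y x' y')

/-- The tensor square is spanned by the elements `x ⊗ y`, since their span is closed under the
bracket. -/
theorem span_tensorBilin :
    Submodule.span R {t | ∃ x y : L, tensorBilin R L x y = t} = ⊤ := by
  let S : LieSubalgebra R (TensorSquare R L) :=
    { Submodule.span R {t | ∃ x y : L, tensorBilin R L x y = t} with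
      lie_mem' := by
        intro a b ha hb
        refine Submodule.span_induction₂ (p := fun a b _ _ =>
          ⁅a, b⁆ ∈ Submodule.span R {t | ∃ x y : L, tensorBilin R L x y = t})
          ?_ ?_ ?_ ?_ ?_ ?_ ?_ ha hb
        · rintro _ _ ⟨x, y, rfl⟩ ⟨x', y', rfl⟩
          rw [lie_tensorBilin]
          exact Submodule.neg_mem _ (Submodule.subset_span ⟨_, _, rfl⟩)
        · intro x _; rw [zero_lie]; exact Submodule.zero_mem _
        · intro x _; rw [lie_zero]; exact Submodule.zero_mem _
        · intro x y z _ _ _ h h'; rw [add_lie]; exact Submodule.add_mem _ h h'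
        · intro x y z _ _ _ h h'; rw [lie_add]; exact Submodule.add_mem _ h h'
        · intro r x y _ _ h; rw [smul_lie]; exact Submodule.smul_mem _ _ h
        · intro r x y _ _ h; rw [lie_smul]; exact Submodule.smul_mem _ _ h }
  let ψ : FreeLieAlgebra R (L × L) →ₗ⁅R⁆ S := FreeLieAlgebra.lift R fun p =>
    ⟨tensorBilin R L p.1 p.2, Submodule.subset_span ⟨_, _, rfl⟩⟩
  have hψ : S.incl.comp ψ = lieQuotientMk (tensorIdeal R L) := by
    refine FreeLieAlgebra.hom_ext fun p => ?_
    rw [LieHom.comp_apply, FreeLieAlgebra.lift_of_apply]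
    rfl
  rw [eq_top_iff]
  intro t _
  obtain ⟨a, rfl⟩ := lieQuotientMk_surjective _ t
  rw [← hψ]
  exact (ψ a).2

theorem tensorSquare_hom_ext {P : Type*} [AddCommGroup P] [Module R P]
    {f g : TensorSquare R L →ₗ[R] P}
    (h : ∀ x y, f (tensorBilin R L x y) = g (tensorBilin R L x y)) : f = g := by
  refine LinearMap.ext_on span_tensorBilin ?_
  rintro _ ⟨x, y, rfl⟩
  exact h x y

section Lift

variable {G : Type*} [LieRing G] [LieAlgebra R G]

/-- The universal property of the tensor square. -/
theorem exists_tensorSquare_hom (c : L →ₗ[R] L →ₗ[R] G)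
    (hl : ∀ x x' y, c ⁅x, x'⁆ y = c x ⁅x', y⁆ - c x' ⁅x, y⁆)
    (hr : ∀ x y y', c x ⁅y, y'⁆ = c ⁅y', x⁆ y - c ⁅y, x⁆ y')
    (hb : ∀ x y x' y', ⁅c x y, c x' y'⁆ = - c ⁅y, x⁆ ⁅x', y'⁆) :
    ∃ φ : TensorSquare R L →ₗ⁅R⁆ G, ∀ x y, φ (tensorBilin R L x y) = c x y := by
  let f : FreeLieAlgebra R (L × L) →ₗ⁅R⁆ G := FreeLieAlgebra.lift R fun p => c p.1 p.2
  have hf : ∀ x y, f (tensorSymbol R L x y) = c x y := fun x y =>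
    FreeLieAlgebra.lift_of_apply _ _
  have hker : tensorIdeal R L ≤ f.ker := by
    rw [LieSubmodule.lieSpan_le]
    intro a ha
    rw [SetLike.mem_coe, LieHom.mem_ker]
    induction ha with
    | smul_left r x y => simp [hf]
    | smul_right r x y => simp [hf]
    | add_left x x' y => simp [hf]
    | add_right x y y' => simp [hf]
    | lie_left x x' y => simp only [map_sub, hf, hl, sub_self]
    | lie_right x y y' => simp only [map_sub, hf, hr x y y', sub_self]
    | lie_lie x y x' y' => simp only [map_sub, map_neg, LieHom.map_lie, hf, hb, sub_self]
  exact ⟨lieQuotientLift _ f hker, fun x y => (lieQuotientLift_mk _ f hker _).trans (hf x y)⟩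

variable (R L) in
/-- The bilinear map `(x, y) ↦ x ∧ y` into the exterior square. -/
def wedgeBilin : L →ₗ[R] L →ₗ[R] ExteriorSquare R L :=
  (tensorBilin R L).compr₂ (lieQuotientMk (squareIdeal R L) : _ →ₗ[R] _)

theorem lieQuotientMk_tensorBilin (x y : L) :
    lieQuotientMk (squareIdeal R L) (tensorBilin R L x y) = wedgeBilin R L x y := rfl

theorem wedgeBilin_self (x : L) : wedgeBilin R L x x = 0 := by
  rw [← lieQuotientMk_tensorBilin, lieQuotientMk_eq_zero]
  exact LieSubmodule.subset_lieSpan ⟨x, rfl⟩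

theorem wedgeBilin_lie_left (x x' y : L) : wedgeBilin R L ⁅x, x'⁆ y =
    wedgeBilin R L x ⁅x', y⁆ - wedgeBilin R L x' ⁅x, y⁆ := by
  simp only [← lieQuotientMk_tensorBilin, tensorBilin_lie_left, map_sub]

theorem exteriorSquare_hom_ext {P : Type*} [AddCommGroup P] [Module R P]
    {f g : ExteriorSquare R L →ₗ[R] P}
    (h : ∀ x y, f (wedgeBilin R L x y) = g (wedgeBilin R L x y)) : f = g := by
  have h2 : f ∘ₗ (squareIdeal R L).toSubmodule.mkQ = g ∘ₗ (squareIdeal R L).toSubmodule.mkQ :=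
    tensorSquare_hom_ext h
  ext t
  obtain ⟨t, rfl⟩ := lieQuotientMk_surjective _ t
  exact LinearMap.congr_fun h2 t

/-- The universal property of the exterior square. -/
theorem exists_exteriorSquare_hom (c : L →ₗ[R] L →ₗ[R] G) (hs : ∀ x, c x x = 0)
    (hl : ∀ x x' y, c ⁅x, x'⁆ y = c x ⁅x', y⁆ - c x' ⁅x, y⁆)
    (hr : ∀ x y y', c x ⁅y, y'⁆ = c ⁅y', x⁆ y - c ⁅y, x⁆ y')
    (hb : ∀ x y x' y', ⁅c x y, c x' y'⁆ = - c ⁅y, x⁆ ⁅x', y'⁆) :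
    ∃ φ : ExteriorSquare R L →ₗ⁅R⁆ G, ∀ x y, φ (wedgeBilin R L x y) = c x y := by
  obtain ⟨f, hf⟩ := exists_tensorSquare_hom c hl hr hb
  have hker : squareIdeal R L ≤ f.ker := by
    rw [LieSubmodule.lieSpan_le]
    rintro _ ⟨x, rfl⟩
    rw [SetLike.mem_coe, LieHom.mem_ker]
    exact (hf x x).trans (hs x)
  exact ⟨lieQuotientLift _ f hker, fun x y => (lieQuotientLift_mk _ f hker _).trans (hf x y)⟩

variable (R L) in
/-- The commutator map `L ∧ L → L`. -/
theorem exists_wedgeCommutator :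
    ∃ β : ExteriorSquare R L →ₗ⁅R⁆ L, ∀ x y, β (wedgeBilin R L x y) = ⁅x, y⁆ := by
  have hker : squareIdeal R L ≤ (commutatorMap R L).ker := by
    rw [LieSubmodule.lieSpan_le]
    rintro _ ⟨x, rfl⟩
    rw [SetLike.mem_coe, LieHom.mem_ker, commutatorMap_tensorElt, lie_self]
  exact ⟨lieQuotientLift _ _ hker, fun x y =>
    (lieQuotientLift_mk _ _ hker _).trans (commutatorMap_tensorElt R L x y)⟩

end Lift

section AbelianTarget

variable {P : Type*} [AddCommGroup P] [Module R P]

/-- A module, regarded as an abelian Lie ring. -/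
abbrev zeroLieRing (P : Type*) [AddCommGroup P] : LieRing P where
  bracket _ _ := 0
  add_lie _ _ _ := (add_zero _).symm
  lie_add _ _ _ := (add_zero _).symm
  lie_self _ := rfl
  leibniz_lie _ _ _ := (add_zero _).symm

/-- A module, regarded as an abelian Lie algebra. -/
abbrev zeroLieAlgebra (R P : Type*) [CommRing R] [AddCommGroup P] [Module R P] :
    let _ := zeroLieRing P
    LieAlgebra R P :=
  let _ := zeroLieRing P
  { lie_smul := fun _ _ _ => (smul_zero _).symm }

theorem exists_tensorSquare_linearMap (c : L →ₗ[R] L →ₗ[R] P)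
    (hl : ∀ x x' y, c ⁅x, x'⁆ y = c x ⁅x', y⁆ - c x' ⁅x, y⁆)
    (hr : ∀ x y y', c x ⁅y, y'⁆ = c ⁅y', x⁆ y - c ⁅y, x⁆ y')
    (hb : ∀ x y x' y' : L, c ⁅y, x⁆ ⁅x', y'⁆ = 0) :
    ∃ φ : TensorSquare R L →ₗ[R] P, ∀ x y, φ (tensorBilin R L x y) = c x y := by
  let _ := zeroLieRing P
  let _ := zeroLieAlgebra R P
  obtain ⟨φ, hφ⟩ := exists_tensorSquare_hom c hl hr
    (fun x y x' y' => by rw [hb, neg_zero]; rfl)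
  exact ⟨φ, hφ⟩

theorem exists_exteriorSquare_linearMap (c : L →ₗ[R] L →ₗ[R] P) (hs : ∀ x, c x x = 0)
    (hl : ∀ x x' y, c ⁅x, x'⁆ y = c x ⁅x', y⁆ - c x' ⁅x, y⁆)
    (hr : ∀ x y y', c x ⁅y, y'⁆ = c ⁅y', x⁆ y - c ⁅y, x⁆ y')
    (hb : ∀ x y x' y' : L, c ⁅y, x⁆ ⁅x', y'⁆ = 0) :
    ∃ φ : ExteriorSquare R L →ₗ[R] P, ∀ x y, φ (wedgeBilin R L x y) = c x y := by
  let _ := zeroLieRing P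
  let _ := zeroLieAlgebra R P
  obtain ⟨φ, hφ⟩ := exists_exteriorSquare_hom c hs hl hr
    (fun x y x' y' => by rw [hb, neg_zero]; rfl)
  exact ⟨φ, hφ⟩

end AbelianTarget

end TensorSquare

noncomputable section Multiplier

section CocycleLift

variable {R : Type*} [CommRing R] {L : Type*} [LieRing L] [LieAlgebra R L]
  {P : Type*} [AddCommGroup P] [Module R P]

/-- The bracket `[(x, p), (y, q)] = ([x, y], c(x, y))` on `L × P`. -/
abbrev cocycleLieRing (c : L →ₗ[R] L →ₗ[R] P) (hs : ∀ x, c x x = 0)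
    (hc : ∀ x y z, c x ⁅y, z⁆ = c ⁅x, y⁆ z + c y ⁅x, z⁆) : LieRing (L × P) where
  bracket a b := (⁅a.1, b.1⁆, c a.1 b.1)
  add_lie a b e := by ext <;> simp
  lie_add a b e := by ext <;> simp
  lie_self a := by ext <;> simp [hs]
  leibniz_lie a b e := by
    ext
    · exact leibniz_lie a.1 b.1 e.1
    · exact hc a.1 b.1 e.1

/-- A homomorphism from a free Lie algebra lifts to the central extension defined by a 2-cocycle;
the second component of such a lift turns brackets into values of the cocycle. -/
theorem exists_linearMap_lie_eq_cocycle {X : Type*} (π : FreeLieAlgebra R X →ₗ⁅R⁆ L)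
    (c : L →ₗ[R] L →ₗ[R] P) (hs : ∀ x, c x x = 0)
    (hc : ∀ x y z, c x ⁅y, z⁆ = c ⁅x, y⁆ z + c y ⁅x, z⁆) :
    ∃ θ : FreeLieAlgebra R X →ₗ[R] P, ∀ f g, θ ⁅f, g⁆ = c (π f) (π g) := by
  let _ : LieRing (L × P) := cocycleLieRing c hs hc
  let _ : LieAlgebra R (L × P) :=
    { (inferInstance : Module R (L × P)) with
      lie_smul := fun r a b => by
        change ((⁅a.1, r • b.1⁆, c a.1 (r • b.1)) : L × P) = r • (⁅a.1, b.1⁆, c a.1 b.1)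
        ext <;> simp }
  let Θ : FreeLieAlgebra R X →ₗ⁅R⁆ L × P :=
    FreeLieAlgebra.lift R fun x => (π (FreeLieAlgebra.of R x), 0)
  let p : L × P →ₗ⁅R⁆ L := { LinearMap.fst R L P with map_lie' := rfl }
  have hp : p.comp Θ = π := by
    refine FreeLieAlgebra.hom_ext fun x => ?_
    rw [LieHom.comp_apply, FreeLieAlgebra.lift_of_apply]
    rfl
  refine ⟨LinearMap.snd R L P ∘ₗ (Θ : _ →ₗ[R] L × P), fun f g => ?_⟩
  have h1 : ∀ f, (Θ f).1 = π f := fun f => LieHom.congr_fun hp f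
  rw [← h1 f, ← h1 g]
  exact congrArg Prod.snd (LieHom.map_lie Θ f g)

end CocycleLift

variable {K : Type*} [Field K] {L : Type*} [LieRing L] [LieAlgebra K L] {X : Type*}

/-- For a presentation `π : F → L` there is a homomorphism `L ∧ L → F / [ker π, F]` sending
`π f ∧ π g` to the class of `[f, g]`. -/
theorem exists_exteriorSquare_hom_quotient {F : Type*} [LieRing F] [LieAlgebra K F]
    (π : F →ₗ⁅K⁆ L) (hπ : Function.Surjective π) :
    ∃ φ : ExteriorSquare K L →ₗ⁅K⁆ F ⧸ ⁅π.ker, (⊤ : LieIdeal K F)⁆, ∀ f g,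
      φ (wedgeBilin K L (π f) (π g)) = lieQuotientMk _ ⁅f, g⁆ := by
  let q := lieQuotientMk ⁅π.ker, (⊤ : LieIdeal K F)⁆
  obtain ⟨s, hs⟩ := LinearMap.exists_rightInverse_of_surjective (π : F →ₗ[K] L)
    (LinearMap.range_eq_top.2 hπ)
  have hs' : ∀ x, π (s x) = x := fun x => LinearMap.congr_fun hs x
  have hcentral : ∀ f g, π f = 0 → q ⁅f, g⁆ = 0 := fun f g hf =>
    lieQuotientMk_eq_zero.2
      (LieSubmodule.lie_mem_lie ((LieHom.mem_ker (f := π) (x := f)).2 hf) (LieSubmodule.mem_top g))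
  -- The bracket modulo `[ker π, F]` depends only on the images of its arguments in `L`.
  have hindep : ∀ f f' g g', π f = π f' → π g = π g' → q ⁅f, g⁆ = q ⁅f', g'⁆ := by
    intro f f' g g' hf hg
    have h1 := hcentral (f - f') g (by rw [map_sub, hf, sub_self])
    have h2 := hcentral (g - g') f' (by rw [map_sub, hg, sub_self])
    rw [sub_lie, map_sub, sub_eq_zero] at h1
    rw [← lie_skew, lie_sub, map_neg, neg_eq_zero, map_sub, sub_eq_zero] at h2
    rw [h1, h2]
  let c : L →ₗ[K] L →ₗ[K] F ⧸ ⁅π.ker, (⊤ : LieIdeal K F)⁆ :=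
    LinearMap.mk₂ K (fun x y => q ⁅s x, s y⁆) (by intros; simp) (by intros; simp)
      (by intros; simp) (by intros; simp)
  have hc : ∀ f g, c (π f) (π g) = q ⁅f, g⁆ := fun f g => hindep _ _ _ _ (hs' _) (hs' _)
  have hφ := exists_exteriorSquare_hom c (fun x => by simp [c]) ?_ ?_ ?_
  · obtain ⟨φ, hφ⟩ := hφ
    exact ⟨φ, fun f g => by rw [hφ, hc]⟩
  · intro x x' y
    obtain ⟨f, rfl⟩ := hπ x
    obtain ⟨f', rfl⟩ := hπ x'
    obtain ⟨g, rfl⟩ := hπ y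
    simp only [← LieHom.map_lie, hc]
    rw [← map_sub, lie_lie]
  · intro x y y'
    obtain ⟨f, rfl⟩ := hπ x
    obtain ⟨g, rfl⟩ := hπ y
    obtain ⟨g', rfl⟩ := hπ y'
    simp only [← LieHom.map_lie, hc]
    rw [← map_sub, ← lie_skew g' f, ← lie_skew g f, neg_lie, neg_lie, leibniz_lie f g g',
      ← lie_skew g ⁅f, g'⁆]
    congr 1
    abel
  · intro x y x' y'
    obtain ⟨f, rfl⟩ := hπ x
    obtain ⟨g, rfl⟩ := hπ y
    obtain ⟨f', rfl⟩ := hπ x'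
    obtain ⟨g', rfl⟩ := hπ y'
    simp only [← LieHom.map_lie, hc]
    rw [← lie_skew g f, neg_lie, map_neg, neg_neg]

/-- Over a field, the Schur multiplier of any free presentation of `L` is the kernel of the
commutator map `L ∧ L → L`. -/
theorem schurMultiplier_equiv (π : FreeLieAlgebra K X →ₗ⁅K⁆ L) (hπ : Function.Surjective π)
    (β : ExteriorSquare K L →ₗ⁅K⁆ L) (hβ : ∀ x y, β (wedgeBilin K L x y) = ⁅x, y⁆) :
    Nonempty (SchurMultiplier π ≃ₗ[K] (β : ExteriorSquare K L →ₗ[K] L).ker) := by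
  obtain ⟨θ, hθ⟩ := exists_linearMap_lie_eq_cocycle π (wedgeBilin K L) wedgeBilin_self
    (fun x y z => by rw [wedgeBilin_lie_left, sub_add_cancel])
  obtain ⟨φ, hφ⟩ := exists_exteriorSquare_hom_quotient π hπ
  have hβθ : ∀ f ∈ derivedIdeal K (FreeLieAlgebra K X), β (θ f) = π f := fun f hf =>
    eq_of_mem_derivedIdeal (f := (β : _ →ₗ[K] L) ∘ₗ θ) (g := (π : _ →ₗ[K] L))
      (fun x y => by simp [hθ, hβ]) hf
  have hφθ : ∀ f ∈ derivedIdeal K (FreeLieAlgebra K X), φ (θ f) = lieQuotientMk _ f := fun f hf =>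
    eq_of_mem_derivedIdeal
      (f := (φ : _ →ₗ[K] FreeLieAlgebra K X ⧸ ⁅π.ker, (⊤ : LieIdeal K (FreeLieAlgebra K X))⁆) ∘ₗ θ)
      (g := ⁅π.ker, (⊤ : LieIdeal K (FreeLieAlgebra K X))⁆.toSubmodule.mkQ)
      (fun x y => (congrArg φ (hθ x y)).trans (hφ x y)) hf
  have hθker : ∀ f ∈ ⁅π.ker, (⊤ : LieIdeal K (FreeLieAlgebra K X))⁆, θ f = 0 := by
    intro f hf
    rw [← LieSubmodule.mem_toSubmodule, LieSubmodule.lieIdeal_oper_eq_linear_span'] at hf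
    refine LinearMap.eqOn_span (f := θ) (g := 0) ?_ hf
    rintro _ ⟨x, hx, y, -, rfl⟩
    rw [hθ, (LieHom.mem_ker (f := π) (x := x)).1 hx]
    simp
  have hsurj : ∀ p, ∃ f ∈ derivedIdeal K (FreeLieAlgebra K X), θ f = p := by
    have htop : (derivedIdeal K (FreeLieAlgebra K X)).toSubmodule.map θ = ⊤ := by
      rw [eq_top_iff]
      have h := exteriorSquare_hom_ext (R := K) (L := L)
        (f := ((derivedIdeal K (FreeLieAlgebra K X)).toSubmodule.map θ).mkQ) (g := 0) (by
          intro x y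
          obtain ⟨f, rfl⟩ := hπ x
          obtain ⟨g, rfl⟩ := hπ y
          rw [← hθ, LinearMap.zero_apply, Submodule.mkQ_apply, Submodule.Quotient.mk_eq_zero]
          exact Submodule.mem_map_of_mem (lie_mem_derivedIdeal f g))
      intro p _
      have hp := LinearMap.congr_fun h p
      rwa [LinearMap.zero_apply, Submodule.mkQ_apply, Submodule.Quotient.mk_eq_zero] at hp
    intro p
    have hp : p ∈ (derivedIdeal K (FreeLieAlgebra K X)).toSubmodule.map θ := by
      rw [htop]; trivial
    obtain ⟨f, hf, rfl⟩ := hp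
    exact ⟨f, hf, rfl⟩
  let A : relationsInDerived π →ₗ[K] (β : ExteriorSquare K L →ₗ[K] L).ker :=
    (θ ∘ₗ (relationsInDerived π).toSubmodule.subtype).codRestrict _ (fun f => by
      have hf : (f : FreeLieAlgebra K X) ∈ π.ker ⊓ derivedIdeal K (FreeLieAlgebra K X) := f.2
      rw [LieSubmodule.mem_inf] at hf
      rw [LinearMap.mem_ker]
      exact (hβθ f hf.2).trans ((LieHom.mem_ker (f := π)).1 hf.1))
  have hA : Function.Surjective A := by
    rintro ⟨p, hp⟩
    obtain ⟨f, hf, rfl⟩ := hsurj p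
    have hker : f ∈ π.ker := by
      rw [LieHom.mem_ker, ← hβθ f hf]
      exact hp
    exact ⟨⟨f, (LieSubmodule.mem_inf ..).2 ⟨hker, hf⟩⟩, rfl⟩
  have hkerA : (LieIdeal.comap (relationsInDerived π).incl
      ⁅π.ker, (⊤ : LieIdeal K (FreeLieAlgebra K X))⁆).toSubmodule = A.ker := by
    ext ⟨f, hf⟩
    rw [LieSubmodule.mem_inf] at hf
    rw [LieSubmodule.mem_toSubmodule, LieIdeal.mem_comap, LinearMap.mem_ker]
    constructor
    · intro h
      exact Subtype.ext (hθker f h)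
    · intro h
      have h0 : θ f = 0 := congrArg Subtype.val h
      refine lieQuotientMk_eq_zero.1 ?_
      change lieQuotientMk _ f = 0
      rw [← hφθ f hf.2, h0, map_zero]
  exact ⟨(Submodule.quotEquivOfEq _ _ hkerA).trans (A.quotKerEquivOfSurjective hA)⟩

end Multiplier

/-! ### The squares of a Lie algebra of class two -/

noncomputable section ClassTwo

open scoped TensorProduct
open Module

section Identities

variable {R : Type*} [CommRing R] {L : Type*} [LieRing L] [LieAlgebra R L]

theorem lie_eq_zero_of_mem_center {z : L} (hz : z ∈ LieAlgebra.center R L) (x : L) :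
    ⁅x, z⁆ = 0 := hz x

theorem lie_eq_zero_of_mem_center_left {z : L} (hz : z ∈ LieAlgebra.center R L) (x : L) :
    ⁅z, x⁆ = 0 := by
  rw [← lie_skew, lie_eq_zero_of_mem_center hz, neg_zero]

theorem tensorBilin_derived_center {a z : L} (ha : a ∈ derivedIdeal R L)
    (hz : z ∈ LieAlgebra.center R L) : tensorBilin R L a z = 0 := by
  refine eq_of_mem_derivedIdeal (f := (tensorBilin R L).flip z) (g := 0) (fun x y => ?_) ha
  rw [LinearMap.flip_apply, tensorBilin_lie_left, lie_eq_zero_of_mem_center hz,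
    lie_eq_zero_of_mem_center hz]
  simp

/-- Substituting one of the two relations for brackets into the other gives a Jacobi identity in
the tensor square. -/
theorem tensorBilin_jacobi (a b c : L) : tensorBilin R L ⁅a, b⁆ c + tensorBilin R L ⁅b, c⁆ a +
    tensorBilin R L ⁅c, a⁆ b = 0 := by
  have h := tensorBilin_lie_left (R := R) a b c
  rw [tensorBilin_lie_right a b c, tensorBilin_lie_right b a c, ← lie_skew b a,
    ← lie_skew c b] at h
  simp only [map_neg, LinearMap.neg_apply] at h
  rw [eq_sub_iff_add_eq, ← sub_eq_zero] at h
  rw [← neg_eq_zero, ← h]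
  abel

theorem tensorBilin_derived_skew {a : L} (x : L) (ha : a ∈ derivedIdeal R L) :
    tensorBilin R L x a = - tensorBilin R L a x := by
  refine eq_of_mem_derivedIdeal (f := tensorBilin R L x) (g := - (tensorBilin R L).flip x)
    (fun b c => ?_) ha
  have h := tensorBilin_jacobi (R := R) b c x
  rw [tensorBilin_lie_right, LinearMap.neg_apply, LinearMap.flip_apply, eq_neg_iff_add_eq_zero,
    ← h, ← lie_skew b x]
  simp only [map_neg, LinearMap.neg_apply]
  abel

/-- The tensor square of a Lie algebra of class at most two is abelian. -/
theorem tensorSquare_lie_eq_zero (hDZ : derivedIdeal R L ≤ LieAlgebra.center R L)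
    (s t : TensorSquare R L) : ⁅s, t⁆ = 0 := by
  have h : (LieModule.toEnd R (TensorSquare R L) (TensorSquare R L) :
      TensorSquare R L →ₗ[R] Module.End R (TensorSquare R L)) = 0 := by
    refine tensorSquare_hom_ext fun x y => tensorSquare_hom_ext fun x' y' => ?_
    change ⁅tensorBilin R L x y, tensorBilin R L x' y'⁆ = 0
    rw [lie_tensorBilin, tensorBilin_derived_center (lie_mem_derivedIdeal _ _)
      (hDZ (lie_mem_derivedIdeal _ _)), neg_zero]
  exact LinearMap.congr_fun (LinearMap.congr_fun h s) t

theorem exteriorSquare_lie_eq_zero (hDZ : derivedIdeal R L ≤ LieAlgebra.center R L)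
    (s t : ExteriorSquare R L) : ⁅s, t⁆ = 0 := by
  obtain ⟨s, rfl⟩ := lieQuotientMk_surjective _ s
  obtain ⟨t, rfl⟩ := lieQuotientMk_surjective _ t
  rw [← LieHom.map_lie, tensorSquare_lie_eq_zero hDZ, map_zero]

end Identities

variable {K : Type*} [Field K] {L : Type*} [LieRing L] [LieAlgebra K L]

variable (K L) in
/-- The bracket of `L`, as a linear map `⋀² (L / Z(L)) → L²`. -/
theorem exists_bracketMap :
    ∃ B : ⋀[K]^2 (L ⧸ LieAlgebra.center K L) →ₗ[K] derivedIdeal K L,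
      (∀ x y, (B (wedgeTwo K _ (lieQuotientMk _ x) (lieQuotientMk _ y)) : L) = ⁅x, y⁆) ∧
      Function.Surjective B := by
  let Z := LieAlgebra.center K L
  obtain ⟨τ, hτ⟩ := LinearMap.exists_rightInverse_of_surjective Z.toSubmodule.mkQ
    (Submodule.range_mkQ _)
  let c : L ⧸ Z →ₗ[K] L ⧸ Z →ₗ[K] derivedIdeal K L :=
    LinearMap.mk₂ K (fun v w => ⟨⁅τ v, τ w⁆, lie_mem_derivedIdeal _ _⟩)
      (fun _ _ _ => Subtype.ext (by simp)) (fun _ _ _ => Subtype.ext (by simp))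
      (fun _ _ _ => Subtype.ext (by simp)) (fun _ _ _ => Subtype.ext (by simp))
  have hZ : ∀ x, τ (lieQuotientMk Z x) - x ∈ Z := by
    intro x
    rw [← lieQuotientMk_eq_zero, map_sub, sub_eq_zero]
    exact LinearMap.congr_fun hτ _
  have hB : ∀ x y, (liftWedgeTwo c (fun v => Subtype.ext (lie_self _))
      (wedgeTwo K _ (lieQuotientMk _ x) (lieQuotientMk _ y)) : L) = ⁅x, y⁆ := by
    intro x y
    rw [liftWedgeTwo_apply]
    change ⁅τ (lieQuotientMk Z x), τ (lieQuotientMk Z y)⁆ = ⁅x, y⁆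
    have h1 := lie_eq_zero_of_mem_center_left (hZ x) (τ (lieQuotientMk Z y))
    have h2 := lie_eq_zero_of_mem_center (hZ y) x
    rw [sub_lie, sub_eq_zero] at h1
    rw [lie_sub, sub_eq_zero] at h2
    rw [h1, h2]
  refine ⟨_, hB, ?_⟩
  rintro ⟨a, ha⟩
  have ha' := ha
  rw [← LieSubmodule.mem_toSubmodule, derivedIdeal_toSubmodule] at ha'
  suffices a ∈ ((derivedIdeal K L).toSubmodule.subtype ∘ₗ liftWedgeTwo c
      (fun v => Subtype.ext (lie_self _))).range by
    obtain ⟨w, hw⟩ := this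
    exact ⟨w, Subtype.ext hw⟩
  refine (Submodule.span_le.2 ?_) ha'
  rintro _ ⟨x, y, rfl⟩
  exact ⟨_, hB x y⟩

section Model

variable (B : ⋀[K]^2 (L ⧸ LieAlgebra.center K L) →ₗ[K] derivedIdeal K L)
  (δ : L →ₗ[K] derivedIdeal K L)

/-- The bilinear map `(x, y) ↦ [ȳ ⊗ δ x] - [x̄ ⊗ δ y]` into the cokernel of the Jacobi map, for a
linear projection `δ : L → L²`. -/
def centralPart : L →ₗ[K] L →ₗ[K]
    ((L ⧸ LieAlgebra.center K L) ⊗[K] derivedIdeal K L) ⧸ (jacobiMap B).range :=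
  LinearMap.mk₂ K (fun x y => (jacobiMap B).range.mkQ
    (lieQuotientMk _ y ⊗ₜ δ x - lieQuotientMk _ x ⊗ₜ δ y))
    (fun x x' y => by
      rw [← map_add]; congr 1; simp only [map_add, TensorProduct.add_tmul, TensorProduct.tmul_add]
      abel)
    (fun r x y => by
      rw [← map_smul]; congr 1
      simp only [map_smul, TensorProduct.tmul_smul, ← TensorProduct.smul_tmul', smul_sub])
    (fun x y y' => by
      rw [← map_add]; congr 1; simp only [map_add, TensorProduct.add_tmul, TensorProduct.tmul_add]
      abel)
    (fun r x y => by
      rw [← map_smul]; congr 1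
      simp only [map_smul, TensorProduct.tmul_smul, ← TensorProduct.smul_tmul', smul_sub])

theorem centralPart_apply (x y : L) : centralPart B δ x y = (jacobiMap B).range.mkQ
    (lieQuotientMk _ y ⊗ₜ δ x - lieQuotientMk _ x ⊗ₜ δ y) := rfl

theorem centralPart_self (x : L) : centralPart B δ x x = 0 := by
  rw [centralPart_apply, sub_self, map_zero]

theorem centralPart_skew (x y : L) : centralPart B δ x y = - centralPart B δ y x := by
  rw [centralPart_apply, centralPart_apply, ← map_neg, neg_sub]

variable {B δ} (hDZ : derivedIdeal K L ≤ LieAlgebra.center K L)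
  (hB : ∀ x y, (B (wedgeTwo K _ (lieQuotientMk _ x) (lieQuotientMk _ y)) : L) = ⁅x, y⁆)
  (hδ : ∀ a : derivedIdeal K L, δ a = a)

include hDZ hδ

theorem centralPart_derived_left (a : derivedIdeal K L) (y : L) :
    centralPart B δ a y = (jacobiMap B).range.mkQ (lieQuotientMk _ y ⊗ₜ a) := by
  rw [centralPart_apply, hδ, lieQuotientMk_eq_zero.2 (hDZ a.2), TensorProduct.zero_tmul, sub_zero]

theorem centralPart_derived_derived (a b : derivedIdeal K L) : centralPart B δ a b = 0 := by
  rw [centralPart_derived_left hDZ hδ, lieQuotientMk_eq_zero.2 (hDZ b.2),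
    TensorProduct.zero_tmul, map_zero]

include hB

theorem centralPart_lie_left (x x' y : L) : centralPart B δ ⁅x, x'⁆ y =
    centralPart B δ x ⁅x', y⁆ - centralPart B δ x' ⁅x, y⁆ := by
  have hb : ∀ u v w : L, centralPart B δ ⁅u, v⁆ w = (jacobiMap B).range.mkQ
      (lieQuotientMk _ w ⊗ₜ B (wedgeTwo K _ (lieQuotientMk _ u) (lieQuotientMk _ v))) := by
    intro u v w
    rw [← hB, centralPart_derived_left hDZ hδ]
  have hj := jacobiMap_apply B ![lieQuotientMk _ y, lieQuotientMk _ x, lieQuotientMk _ x']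
  rw [centralPart_skew B δ x, centralPart_skew B δ x', ← lie_skew x y, map_neg,
    LinearMap.neg_apply, ← sub_eq_zero, hb, hb, hb]
  have h0 : (jacobiMap B).range.mkQ (jacobiMap B (exteriorPower.ιMulti K 3
      ![lieQuotientMk _ y, lieQuotientMk _ x, lieQuotientMk _ x'])) = 0 := by
    rw [Submodule.mkQ_apply, Submodule.Quotient.mk_eq_zero]
    exact ⟨_, rfl⟩
  rw [hj] at h0
  simp only [map_add] at h0
  rw [← h0]
  simp only [Matrix.cons_val]
  abel

theorem centralPart_lie_right (x y y' : L) : centralPart B δ x ⁅y, y'⁆ =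
    centralPart B δ ⁅y', x⁆ y - centralPart B δ ⁅y, x⁆ y' := by
  rw [centralPart_skew B δ x, centralPart_lie_left hDZ hB hδ, centralPart_skew B δ y,
    centralPart_skew B δ y']
  abel

end Model

section Equivalence

variable {B : ⋀[K]^2 (L ⧸ LieAlgebra.center K L) →ₗ[K] derivedIdeal K L}
  {δ : L →ₗ[K] derivedIdeal K L} (hDZ : derivedIdeal K L ≤ LieAlgebra.center K L)
  (hB : ∀ x y, (B (wedgeTwo K _ (lieQuotientMk _ x) (lieQuotientMk _ y)) : L) = ⁅x, y⁆)
  (hδ : ∀ a : derivedIdeal K L, δ a = a)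

variable (B δ) in
/-- The bilinear map `(x, y) ↦ (c(x̄, ȳ), κ(x, y))`, where `c` is bilinear on `L / L²` and `κ` is
`centralPart B δ`. -/
def modelBilin {P : Type*} [AddCommGroup P] [Module K P]
    (c : (L ⧸ derivedIdeal K L) →ₗ[K] (L ⧸ derivedIdeal K L) →ₗ[K] P) : L →ₗ[K] L →ₗ[K]
      P × (((L ⧸ LieAlgebra.center K L) ⊗[K] derivedIdeal K L) ⧸ (jacobiMap B).range) :=
  LinearMap.mk₂ K (fun x y => (c (lieQuotientMk _ x) (lieQuotientMk _ y), centralPart B δ x y))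
    (by intros; simp) (by intros; simp) (by intros; simp) (by intros; simp)

theorem modelBilin_apply {P : Type*} [AddCommGroup P] [Module K P]
    (c : (L ⧸ derivedIdeal K L) →ₗ[K] (L ⧸ derivedIdeal K L) →ₗ[K] P) (x y : L) :
    modelBilin B δ c x y = (c (lieQuotientMk _ x) (lieQuotientMk _ y), centralPart B δ x y) := rfl

theorem lieQuotientMk_derivedIdeal_lie (x y : L) :
    lieQuotientMk (derivedIdeal K L) ⁅x, y⁆ = 0 :=
  lieQuotientMk_eq_zero.2 (lie_mem_derivedIdeal x y)

include hDZ hB hδ in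
theorem modelBilin_relations {P : Type*} [AddCommGroup P] [Module K P]
    (c : (L ⧸ derivedIdeal K L) →ₗ[K] (L ⧸ derivedIdeal K L) →ₗ[K] P) :
    (∀ x x' y : L, modelBilin B δ c ⁅x, x'⁆ y =
      modelBilin B δ c x ⁅x', y⁆ - modelBilin B δ c x' ⁅x, y⁆) ∧
    (∀ x y y' : L, modelBilin B δ c x ⁅y, y'⁆ =
      modelBilin B δ c ⁅y', x⁆ y - modelBilin B δ c ⁅y, x⁆ y') ∧
    ∀ x y x' y' : L, modelBilin B δ c ⁅y, x⁆ ⁅x', y'⁆ = 0 := by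
  refine ⟨fun x x' y => ?_, fun x y y' => ?_, fun x y x' y' => ?_⟩
  · simp only [modelBilin_apply, lieQuotientMk_derivedIdeal_lie, map_zero, LinearMap.zero_apply,
      centralPart_lie_left hDZ hB hδ x x' y, Prod.mk_sub_mk, sub_self]
  · simp only [modelBilin_apply, lieQuotientMk_derivedIdeal_lie, map_zero, LinearMap.zero_apply,
      centralPart_lie_right hDZ hB hδ x y y', Prod.mk_sub_mk, sub_self]
  · have h := centralPart_derived_derived (B := B) hDZ hδ ⟨_, lie_mem_derivedIdeal y x⟩
      ⟨_, lie_mem_derivedIdeal x' y'⟩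
    simp only [modelBilin_apply, lieQuotientMk_derivedIdeal_lie, map_zero]
    exact Prod.ext rfl h

include hB in
/-- The map from the cokernel of the Jacobi map to `L ⊗ L` sending the class of `x̄ ⊗ a` to
`a ⊗ x`. -/
theorem exists_coker_linearMap :
    ∃ ψ : ((L ⧸ LieAlgebra.center K L) ⊗[K] derivedIdeal K L) ⧸ (jacobiMap B).range →ₗ[K]
      TensorSquare K L, ∀ (x : L) (a : derivedIdeal K L),
        ψ ((jacobiMap B).range.mkQ (lieQuotientMk _ x ⊗ₜ a)) = tensorBilin K L a x := by
  obtain ⟨τ, hτ⟩ := LinearMap.exists_rightInverse_of_surjective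
    (LieAlgebra.center K L).toSubmodule.mkQ (Submodule.range_mkQ _)
  have hτ' : ∀ v, lieQuotientMk (LieAlgebra.center K L) (τ v) = v :=
    fun v => LinearMap.congr_fun hτ v
  have hZ : ∀ x, τ (lieQuotientMk (LieAlgebra.center K L) x) - x ∈ LieAlgebra.center K L := by
    intro x
    rw [← lieQuotientMk_eq_zero, map_sub, hτ', sub_self]
  let g : (L ⧸ LieAlgebra.center K L) ⊗[K] derivedIdeal K L →ₗ[K] TensorSquare K L :=
    TensorProduct.lift
      ((tensorBilin K L).flip.compl₁₂ τ (derivedIdeal K L).toSubmodule.subtype)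
  have hg : ∀ (x : L) (a : derivedIdeal K L),
      g (lieQuotientMk _ x ⊗ₜ a) = tensorBilin K L a x := by
    intro x a
    change tensorBilin K L a (τ (lieQuotientMk (LieAlgebra.center K L) x)) = _
    rw [← sub_eq_zero, ← map_sub]
    exact tensorBilin_derived_center a.2 (hZ x)
  have hker : (jacobiMap B).range ≤ g.ker := by
    rw [LinearMap.range_le_ker_iff]
    refine exteriorPower.linearMap_ext (AlternatingMap.ext fun v => ?_)
    obtain ⟨x, hx⟩ : ∃ x : Fin 3 → L, ∀ i, v i = lieQuotientMk (LieAlgebra.center K L) (x i) :=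
      ⟨fun i => τ (v i), fun i => (hτ' _).symm⟩
    change g (jacobiMap B (exteriorPower.ιMulti K 3 v)) = 0
    rw [jacobiMap_apply, hx 0, hx 1, hx 2]
    simp only [map_add, hg, hB]
    rw [← tensorBilin_jacobi (R := K) (x 0) (x 1) (x 2)]
    abel
  exact ⟨(jacobiMap B).range.liftQ g hker, fun x a => hg x a⟩

variable {σ : (L ⧸ derivedIdeal K L) →ₗ[K] L}
  (hσ : ∀ v, lieQuotientMk (derivedIdeal K L) (σ v) = v)
  (hσδ : ∀ x, σ (lieQuotientMk (derivedIdeal K L) x) + δ x = x)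
  {ψ : ((L ⧸ LieAlgebra.center K L) ⊗[K] derivedIdeal K L) ⧸ (jacobiMap B).range →ₗ[K]
      TensorSquare K L}
  (hψ : ∀ (x : L) (a : derivedIdeal K L),
    ψ ((jacobiMap B).range.mkQ (lieQuotientMk _ x ⊗ₜ a)) = tensorBilin K L a x)

include hDZ hσδ hψ in
theorem tensorBilin_decomposition (x y : L) : tensorBilin K L x y =
    tensorBilin K L (σ (lieQuotientMk _ x)) (σ (lieQuotientMk _ y)) +
      ψ (centralPart B δ x y) := by
  rw [centralPart_apply, map_sub, map_sub, hψ, hψ]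
  have hx := hσδ x
  have hy := hσδ y
  set u := σ (lieQuotientMk _ x)
  set v := σ (lieQuotientMk _ y)
  have h1 : tensorBilin K L (δ x) (δ y) = 0 :=
    tensorBilin_derived_center (δ x).2 (hDZ (δ y).2)
  have h2 : tensorBilin K L (δ y) (δ x) = 0 :=
    tensorBilin_derived_center (δ y).2 (hDZ (δ x).2)
  have h3 := tensorBilin_derived_skew u (δ y).2
  have h4 : tensorBilin K L (δ x) y = tensorBilin K L (δ x) v := by
    conv_lhs => rw [← hy, map_add, h1, add_zero]
  have h5 : tensorBilin K L (δ y) x = tensorBilin K L (δ y) u := by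
    conv_lhs => rw [← hx, map_add, h2, add_zero]
  have h6 : tensorBilin K L x y = tensorBilin K L (u + δ x) (v + δ y) := by rw [hx, hy]
  rw [h4, h5, h6]
  simp only [map_add, LinearMap.add_apply, h1, h3]
  abel

include hσ hσδ in
theorem projection_section (v : L ⧸ derivedIdeal K L) : δ (σ v) = 0 := by
  have h := hσδ (σ v)
  rw [hσ, add_eq_left] at h
  exact Subtype.ext h

include hDZ hσ hσδ hδ in
theorem modelBilin_section {P : Type*} [AddCommGroup P] [Module K P]
    (c : (L ⧸ derivedIdeal K L) →ₗ[K] (L ⧸ derivedIdeal K L) →ₗ[K] P) :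
    (∀ v w, modelBilin B δ c (σ v) (σ w) = (c v w, 0)) ∧
    ∀ (a : derivedIdeal K L) x, modelBilin B δ c a x =
      (0, (jacobiMap B).range.mkQ (lieQuotientMk _ x ⊗ₜ a)) := by
  refine ⟨fun v w => ?_, fun a x => ?_⟩
  · rw [modelBilin_apply, hσ, hσ, centralPart_apply, projection_section hσ hσδ,
      projection_section hσ hσδ, TensorProduct.tmul_zero, TensorProduct.tmul_zero, sub_zero,
      map_zero]
  · rw [modelBilin_apply, centralPart_derived_left hDZ hδ, lieQuotientMk_eq_zero.2 a.2, map_zero,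
      LinearMap.zero_apply]

theorem coker_linearMap_ext {P : Type*} [AddCommGroup P] [Module K P]
    {f g : ((L ⧸ LieAlgebra.center K L) ⊗[K] derivedIdeal K L) ⧸ (jacobiMap B).range →ₗ[K] P}
    (h : ∀ (x : L) (a : derivedIdeal K L), f ((jacobiMap B).range.mkQ (lieQuotientMk _ x ⊗ₜ a)) =
      g ((jacobiMap B).range.mkQ (lieQuotientMk _ x ⊗ₜ a))) : f = g := by
  refine Submodule.linearMap_qext _ (TensorProduct.ext' fun v a => ?_)
  obtain ⟨x, rfl⟩ := lieQuotientMk_surjective _ v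
  exact h x a

include hDZ hB hδ hσ hσδ hψ in
theorem tensorSquare_equiv : Nonempty (TensorSquare K L ≃ₗ[K]
    ((L ⧸ derivedIdeal K L) ⊗[K] (L ⧸ derivedIdeal K L)) ×
      (((L ⧸ LieAlgebra.center K L) ⊗[K] derivedIdeal K L) ⧸ (jacobiMap B).range)) := by
  let c := TensorProduct.mk K (L ⧸ derivedIdeal K L) (L ⧸ derivedIdeal K L)
  obtain ⟨hl, hr, hb⟩ := modelBilin_relations hDZ hB hδ c
  obtain ⟨hs, ha⟩ := modelBilin_section (B := B) hDZ hδ hσ hσδ c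
  obtain ⟨f, hf⟩ := exists_tensorSquare_linearMap (modelBilin B δ c) hl hr hb
  let g₁ := TensorProduct.lift ((tensorBilin K L).compl₁₂ σ σ)
  refine ⟨LinearEquiv.ofLinearMap f (g₁.coprod ψ) ?_ ?_⟩
  · refine LinearMap.prod_ext (TensorProduct.ext' fun v w => ?_)
      (coker_linearMap_ext fun x a => ?_)
    · have h : f (tensorBilin K L (σ v) (σ w)) = (v ⊗ₜ w, 0) := (hf _ _).trans (hs v w)
      simpa [g₁] using h
    · have h := (hf a x).trans (ha a x)
      rw [← hψ] at h
      simpa using h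
  · refine tensorSquare_hom_ext fun x y => ?_
    rw [LinearMap.comp_apply, hf, modelBilin_apply, LinearMap.coprod_apply]
    exact (tensorBilin_decomposition hDZ hσδ hψ x y).symm

include hDZ hB hδ hσ hσδ hψ in
theorem exteriorSquare_equiv : Nonempty (ExteriorSquare K L ≃ₗ[K]
    (⋀[K]^2 (L ⧸ derivedIdeal K L)) ×
      (((L ⧸ LieAlgebra.center K L) ⊗[K] derivedIdeal K L) ⧸ (jacobiMap B).range)) := by
  let c := wedgeTwo K (L ⧸ derivedIdeal K L)
  obtain ⟨hl, hr, hb⟩ := modelBilin_relations hDZ hB hδ c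
  obtain ⟨hs, ha⟩ := modelBilin_section (B := B) hDZ hδ hσ hσδ c
  obtain ⟨f, hf⟩ := exists_exteriorSquare_linearMap (modelBilin B δ c)
    (fun x => by rw [modelBilin_apply, wedgeTwo_self, centralPart_self]; rfl) hl hr hb
  let g₁ := liftWedgeTwo ((wedgeBilin K L).compl₁₂ σ σ) (fun v => wedgeBilin_self _)
  have hg₁ : ∀ v w, g₁ (wedgeTwo K _ v w) = wedgeBilin K L (σ v) (σ w) := fun v w =>
    liftWedgeTwo_apply _ _ v w
  let g₂ := (squareIdeal K L).toSubmodule.mkQ ∘ₗ ψ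
  refine ⟨LinearEquiv.ofLinearMap f (g₁.coprod g₂) ?_ ?_⟩
  · refine LinearMap.prod_ext (wedgeTwo_ext fun v w => ?_) (coker_linearMap_ext fun x a => ?_)
    · have h : f (wedgeBilin K L (σ v) (σ w)) = (wedgeTwo K _ v w, 0) := (hf _ _).trans (hs v w)
      change f (g₁ (wedgeTwo K _ v w) + g₂ 0) = _
      rw [map_zero, add_zero, hg₁]
      exact h
    · have h := (hf a x).trans (ha a x)
      rw [← lieQuotientMk_tensorBilin, ← hψ] at h
      simp only [LinearMap.comp_apply, LinearMap.inr_apply, LinearMap.coprod_apply, map_zero,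
        zero_add, LinearMap.id_apply]
      exact h
  · refine exteriorSquare_hom_ext fun x y => ?_
    rw [LinearMap.comp_apply, hf, modelBilin_apply, LinearMap.coprod_apply, hg₁]
    have h := congrArg (lieQuotientMk (squareIdeal K L))
      (tensorBilin_decomposition hDZ hσδ hψ x y)
    rw [map_add] at h
    exact h.symm

end Equivalence

/-- For `L` of class at most two, with `Q` the cokernel of the Jacobi map of the bracket
`⋀² (L / Z(L)) → L²`, the tensor square is `(L / L²) ⊗ (L / L²) × Q` and the exterior square is
`⋀² (L / L²) × Q`. -/
theorem exists_square_equivs (hDZ : derivedIdeal K L ≤ LieAlgebra.center K L) :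
    ∃ B : ⋀[K]^2 (L ⧸ LieAlgebra.center K L) →ₗ[K] derivedIdeal K L, Function.Surjective B ∧
      Nonempty (TensorSquare K L ≃ₗ[K]
        ((L ⧸ derivedIdeal K L) ⊗[K] (L ⧸ derivedIdeal K L)) ×
          (((L ⧸ LieAlgebra.center K L) ⊗[K] derivedIdeal K L) ⧸ (jacobiMap B).range)) ∧
      Nonempty (ExteriorSquare K L ≃ₗ[K] (⋀[K]^2 (L ⧸ derivedIdeal K L)) ×
          (((L ⧸ LieAlgebra.center K L) ⊗[K] derivedIdeal K L) ⧸ (jacobiMap B).range)) := by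
  obtain ⟨B, hB, hBs⟩ := exists_bracketMap K L
  obtain ⟨ψ, hψ⟩ := exists_coker_linearMap hB
  obtain ⟨σ, hσ⟩ := LinearMap.exists_rightInverse_of_surjective
    (derivedIdeal K L).toSubmodule.mkQ (Submodule.range_mkQ _)
  have hσ' : ∀ v, lieQuotientMk (derivedIdeal K L) (σ v) = v := fun v => LinearMap.congr_fun hσ v
  let δ : L →ₗ[K] derivedIdeal K L :=
    (LinearMap.id - σ ∘ₗ (derivedIdeal K L).toSubmodule.mkQ).codRestrict
      (derivedIdeal K L).toSubmodule (fun x => by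
        rw [LieSubmodule.mem_toSubmodule, ← lieQuotientMk_eq_zero]
        change lieQuotientMk _ (x - σ (lieQuotientMk (derivedIdeal K L) x)) = 0
        rw [map_sub, hσ', sub_self])
  have hδ : ∀ x, (δ x : L) = x - σ (lieQuotientMk (derivedIdeal K L) x) := fun x => rfl
  have hσδ : ∀ x, σ (lieQuotientMk (derivedIdeal K L) x) + δ x = x := fun x => by
    rw [hδ, add_sub_cancel]
  have hδ' : ∀ a : derivedIdeal K L, δ a = a := fun a => Subtype.ext (by
    rw [hδ, lieQuotientMk_eq_zero.2 a.2, map_zero, sub_zero])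
  exact ⟨B, hBs, tensorSquare_equiv hDZ hB hδ' hσ' hσδ hψ,
    exteriorSquare_equiv hDZ hB hδ' hσ' hσδ hψ⟩

end ClassTwo

/-! ### Decompositions and dimensions -/

noncomputable section Decomposition

open Module

variable {K : Type*} [Field K] {L : Type*} [LieRing L] [LieAlgebra K L]

instance (n : ℕ) : FiniteDimensional K (AbelianLie K n) :=
  inferInstanceAs (FiniteDimensional K (Fin n → K))

theorem finrank_abelianLie (n : ℕ) : finrank K (AbelianLie K n) = n :=
  Module.finrank_fin_fun K

theorem isIsoAbelian_of_finrank {M : Type*} [LieRing M] [LieAlgebra K M] [FiniteDimensional K M]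
    (hM : ∀ x y : M, ⁅x, y⁆ = 0) {q : ℚ} (hq : (finrank K M : ℚ) = q) : IsIsoAbelian K M q := by
  let e : M ≃ₗ[K] AbelianLie K (finrank K M) :=
    LinearEquiv.ofFinrankEq _ _ (finrank_abelianLie _).symm
  exact ⟨finrank K M, hq, ⟨{ e with
    map_lie' := by
      intro x y
      change e ⁅x, y⁆ = 0
      rw [hM, map_zero] }⟩⟩

theorem derivedIdeal_le_center (h : LieModule.nilpotencyLength L L = 2) :
    derivedIdeal K L ≤ LieAlgebra.center K L := by
  have h2 := ((LieModule.nilpotencyLength_eq_succ_iff K L L 1).1 h).1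
  intro a ha x
  have hmem : ⁅x, a⁆ ∈ LieModule.lowerCentralSeries K L L 2 := by
    rw [LieModule.lowerCentralSeries_succ, LieModule.lowerCentralSeries_succ,
      LieModule.lowerCentralSeries_zero]
    exact LieSubmodule.lie_mem_lie (LieSubmodule.mem_top x) ha
  rw [h2] at hmem
  exact (LieSubmodule.mem_bot _).1 hmem

section CentralComplement

variable {H : Type*} [LieRing H] [LieAlgebra K H] (ι : H →ₗ⁅K⁆ L)
  (hι : ∀ x, ∃ h, x - ι h ∈ LieAlgebra.center K L)

include hι

/-- If `H` and the centre span `L`, then `L² = H²`. -/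
theorem map_derivedIdeal :
    (derivedIdeal K H).toSubmodule.map (ι : H →ₗ[K] L) = (derivedIdeal K L).toSubmodule := by
  rw [derivedIdeal_toSubmodule, derivedIdeal_toSubmodule, Submodule.map_span]
  congr 1
  ext z
  constructor
  · rintro ⟨_, ⟨x, y, rfl⟩, rfl⟩
    exact ⟨ι x, ι y, (LieHom.map_lie ι x y).symm⟩
  · rintro ⟨x, y, rfl⟩
    obtain ⟨g, hg⟩ := hι x
    obtain ⟨h, hh⟩ := hι y
    refine ⟨⁅g, h⁆, ⟨g, h, rfl⟩, ?_⟩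
    have h1 := lie_eq_zero_of_mem_center_left hg y
    have h2 := lie_eq_zero_of_mem_center hh (ι g)
    rw [sub_lie, sub_eq_zero] at h1
    rw [lie_sub, sub_eq_zero] at h2
    rw [h1, h2]
    exact LieHom.map_lie ι g h

theorem mem_center_iff_of_central_complement (hinj : Function.Injective ι) (h : H) :
    h ∈ LieAlgebra.center K H ↔ ι h ∈ LieAlgebra.center K L := by
  constructor
  · intro hh x
    obtain ⟨g, hg⟩ := hι x
    have h1 := lie_eq_zero_of_mem_center_left hg (ι h)
    rw [sub_lie, sub_eq_zero] at h1
    rw [h1, ← LieHom.map_lie, lie_eq_zero_of_mem_center hh, map_zero]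
  · intro hh g
    apply hinj
    rw [LieHom.map_lie, lie_eq_zero_of_mem_center hh, map_zero]

end CentralComplement

/-- The dimensions attached to a decomposition `L ≅ H ⊕ A(t)` with `H² = Z(H)`. -/
theorem finrank_of_decomposition [FiniteDimensional K L] {H : Type*} [LieRing H] [LieAlgebra K H]
    (hH : derivedIdeal K H = LieAlgebra.center K H) {t : ℕ} (e : L ≃ₗ⁅K⁆ H × AbelianLie K t) :
    finrank K (derivedIdeal K H) = finrank K (derivedIdeal K L) ∧
    finrank K (H ⧸ derivedIdeal K H) = finrank K (L ⧸ LieAlgebra.center K L) ∧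
    finrank K (L ⧸ derivedIdeal K L) = finrank K (L ⧸ LieAlgebra.center K L) + t := by
  let el : L ≃ₗ[K] H × AbelianLie K t := e.toLinearEquiv
  have hfinP : FiniteDimensional K (H × AbelianLie K t) := el.finiteDimensional
  have hfin : FiniteDimensional K H :=
    FiniteDimensional.of_surjective (LinearMap.fst K H (AbelianLie K t)) LinearMap.fst_surjective
  let ι : H →ₗ⁅K⁆ L := (e.symm : H × AbelianLie K t →ₗ⁅K⁆ L).comp (LieHom.inl K H _)
  have hιe : ∀ h, e (ι h) = (h, 0) := fun h => e.apply_symm_apply _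
  have hinj : Function.Injective ι := fun g h hgh => by
    have := congrArg e hgh
    rw [hιe, hιe] at this
    exact congrArg Prod.fst this
  have hc : ∀ x, x - ι (e x).1 ∈ LieAlgebra.center K L := by
    intro x y
    refine el.injective ?_
    change e ⁅y, x - ι (e x).1⁆ = e 0
    rw [LieEquiv.map_lie, map_sub, hιe, map_zero]
    refine Prod.ext ?_ rfl
    change ⁅(e y).1, (e x).1 - (e x).1⁆ = 0
    rw [sub_self, lie_zero]
  have hι : ∀ x, ∃ h, x - ι h ∈ LieAlgebra.center K L := fun x => ⟨_, hc x⟩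
  have h1 : finrank K (derivedIdeal K H) = finrank K (derivedIdeal K L) := by
    have h := (Submodule.equivMapOfInjective (ι : H →ₗ[K] L) hinj
      (derivedIdeal K H).toSubmodule).finrank_eq
    rw [map_derivedIdeal ι hι] at h
    exact h
  let p : L →ₗ[K] H ⧸ LieAlgebra.center K H :=
    (LieAlgebra.center K H).toSubmodule.mkQ ∘ₗ LinearMap.fst K H (AbelianLie K t) ∘ₗ el.toLinearMap
  have hp : p.range = ⊤ := by
    rw [LinearMap.range_eq_top]
    exact (Submodule.mkQ_surjective _).comp
      ((LinearMap.fst_surjective (R := K) (M := H) (M₂ := AbelianLie K t)).comp el.surjective)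
  have hker : p.ker = (LieAlgebra.center K L).toSubmodule := by
    ext x
    have hx : p x = 0 ↔ (e x).1 ∈ LieAlgebra.center K H := lieQuotientMk_eq_zero
    rw [LinearMap.mem_ker, hx, mem_center_iff_of_central_complement ι hι hinj,
      LieSubmodule.mem_toSubmodule]
    constructor
    · intro h
      simpa using add_mem (hc x) h
    · intro h
      simpa using sub_mem h (hc x)
  have h2 := p.finrank_range_add_finrank_ker
  rw [hp, finrank_top, hker] at h2
  have h3 : finrank K L = finrank K H + t := by
    rw [el.finrank_eq, finrank_prod, finrank_abelianLie]
  have h4 : finrank K (L ⧸ LieAlgebra.center K L) + finrank K (LieAlgebra.center K L) =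
      finrank K L := Submodule.finrank_quotient_add_finrank _
  have h5 : finrank K (L ⧸ derivedIdeal K L) + finrank K (derivedIdeal K L) = finrank K L :=
    Submodule.finrank_quotient_add_finrank _
  have h6 : finrank K (H ⧸ LieAlgebra.center K H) + finrank K (LieAlgebra.center K H) =
      finrank K H := Submodule.finrank_quotient_add_finrank _
  have h2' : finrank K (H ⧸ LieAlgebra.center K H) + finrank K (LieAlgebra.center K L) =
      finrank K L := h2
  rw [hH] at h1 ⊢
  refine ⟨h1, ?_, ?_⟩ <;> omega

/-- A Lie algebra of class at most two is the direct sum of an ideal `H` with `H² = Z(H)` and a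
central ideal: take for the latter a complement of `L²` in the centre, and for `H` the sum of `L²`
and a complement of the centre. -/
theorem exists_decomposition [FiniteDimensional K L]
    (hDZ : derivedIdeal K L ≤ LieAlgebra.center K L) :
    ∃ (t : ℕ) (H : LieIdeal K L), derivedIdeal K H = LieAlgebra.center K H ∧
      Nonempty (L ≃ₗ⁅K⁆ H × AbelianLie K t) := by
  let D := (derivedIdeal K L).toSubmodule
  let Z := (LieAlgebra.center K L).toSubmodule
  have hDZ' : D ≤ Z := hDZ
  obtain ⟨C₀, hC₀⟩ := Submodule.exists_isCompl D
  obtain ⟨E, hE⟩ := Submodule.exists_isCompl Z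
  let C := C₀ ⊓ Z
  have hDC : D ⊔ C = Z := by
    rw [← sup_inf_assoc_of_le C₀ hDZ', hC₀.sup_eq_top, top_inf_eq]
  have hHZ : (D ⊔ E) ⊓ Z = D := by
    rw [sup_inf_assoc_of_le E hDZ', inf_comm, hE.inf_eq_bot, sup_bot_eq]
  have hcompl : IsCompl (D ⊔ E) C := by
    constructor
    · rw [disjoint_iff, eq_bot_iff]
      rintro x ⟨hx, hxC⟩
      have hxD : x ∈ D := hHZ ▸ ⟨hx, hxC.2⟩
      exact hC₀.inf_eq_bot ▸ ⟨hxD, hxC.1⟩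
    · rw [codisjoint_iff, sup_right_comm, hDC, hE.sup_eq_top]
  let H : LieIdeal K L :=
    { D ⊔ E with
      lie_mem := fun {x m} _ => Submodule.mem_sup_left (lie_mem_derivedIdeal (R := K) x m) }
  have hcomplH : IsCompl H.toSubmodule C := hcompl
  have hC : ∀ c ∈ C, c ∈ LieAlgebra.center K L := fun c hc => hc.2
  let ec : C ≃ₗ[K] AbelianLie K (finrank K C) :=
    LinearEquiv.ofFinrankEq _ _ (finrank_abelianLie _).symm
  have hι : ∀ x, ∃ h : H, x - H.incl h ∈ LieAlgebra.center K L := by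
    intro x
    have hx : x ∈ H.toSubmodule ⊔ C := by rw [hcomplH.sup_eq_top]; trivial
    obtain ⟨h, hh, c, hc, rfl⟩ := Submodule.mem_sup.1 hx
    refine ⟨⟨h, hh⟩, ?_⟩
    change h + c - h ∈ _
    rw [add_sub_cancel_left]
    exact hC c hc
  have hinj : Function.Injective H.incl := Subtype.val_injective
  refine ⟨finrank K C, H, ?_, ?_⟩
  · ext h
    rw [mem_center_iff_of_central_complement H.incl hι hinj]
    have h1 : h ∈ derivedIdeal K H ↔ (h : L) ∈ D := by
      rw [show D = _ from (map_derivedIdeal H.incl hι).symm]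
      constructor
      · exact fun hh => ⟨h, hh, rfl⟩
      · rintro ⟨g, hg, hgh⟩
        rwa [← hinj hgh]
    rw [h1]
    exact ⟨fun hh => hDZ' hh, fun hh => hHZ ▸ ⟨h.2, hh⟩⟩
  · let el : (H × AbelianLie K (finrank K C)) ≃ₗ[K] L :=
      ((LinearEquiv.refl K H).prodCongr ec.symm).trans
        (Submodule.prodEquivOfIsCompl H.toSubmodule C hcomplH)
    have hel : ∀ h a, el (h, a) = (h : L) + ec.symm a := fun h a => rfl
    let e : (H × AbelianLie K (finrank K C)) ≃ₗ⁅K⁆ L :=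
      { el with
        map_lie' := by
          rintro ⟨h, a⟩ ⟨g, b⟩
          change el (⁅h, g⁆, 0) = ⁅el (h, a), el (g, b)⁆
          have ha := hC _ (ec.symm a).2
          have hb := hC _ (ec.symm b).2
          rw [hel, hel, hel, map_zero, add_lie, lie_add, lie_eq_zero_of_mem_center hb,
            lie_eq_zero_of_mem_center_left ha]
          simp }
    exact ⟨e.symm⟩

end Decomposition

noncomputable section Dimensions

open scoped TensorProduct
open Module

theorem cast_choose_three (d : ℕ) : (d.choose 3 : ℚ) = d * (d - 1) * (d - 2) / 6 := by
  induction d with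
  | zero => simp
  | succ d ih =>
    rw [Nat.choose_succ_succ' d 2, Nat.cast_add, ih, Nat.cast_choose_two]
    push_cast
    ring

variable {K : Type*} [Field K] {L : Type*} [LieRing L] [LieAlgebra K L]

theorem range_of_tensorBilin {f : TensorSquare K L →ₗ[K] L}
    (hf : ∀ x y, f (tensorBilin K L x y) = ⁅x, y⁆) : f.range = (derivedIdeal K L).toSubmodule := by
  rw [derivedIdeal_toSubmodule, LinearMap.range_eq_map, ← span_tensorBilin, Submodule.map_span]
  congr 1
  ext z
  constructor
  · rintro ⟨_, ⟨x, y, rfl⟩, rfl⟩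
    exact ⟨x, y, (hf x y).symm⟩
  · rintro ⟨x, y, rfl⟩
    exact ⟨_, ⟨x, y, rfl⟩, hf x y⟩

theorem schurMultiplier_lie_eq_zero {X : Type*} (π : FreeLieAlgebra K X →ₗ⁅K⁆ L)
    (s t : SchurMultiplier π) : ⁅s, t⁆ = 0 := by
  obtain ⟨f, rfl⟩ := lieQuotientMk_surjective _ s
  obtain ⟨g, rfl⟩ := lieQuotientMk_surjective _ t
  rw [← LieHom.map_lie, lieQuotientMk_eq_zero, LieIdeal.mem_comap]
  exact LieSubmodule.lie_mem_lie ((LieSubmodule.mem_inf ..).1 f.2).1 (LieSubmodule.mem_top _)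

/-- The dimensions of the four functors for `L` of class at most two. Here `r` is the number of
relations `dim ⋀² (L / Z(L)) - dim L²`, `q` is the dimension of the cokernel of the Jacobi map and
`s` that of its kernel. -/
theorem exists_finrank_formulas [FiniteDimensional K L]
    (hDZ : derivedIdeal K L ≤ LieAlgebra.center K L) {X : Type*}
    (π : FreeLieAlgebra K X →ₗ⁅K⁆ L) (hπ : Function.Surjective π) {d n m : ℕ}
    (hd : finrank K (L ⧸ LieAlgebra.center K L) = d) (hn : finrank K (L ⧸ derivedIdeal K L) = n)
    (hm : finrank K (derivedIdeal K L) = m) :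
    FiniteDimensional K (SchurMultiplier π) ∧ FiniteDimensional K (ExteriorSquare K L) ∧
    FiniteDimensional K (TensorSquare K L) ∧
    ∃ r q s : ℕ, r + m = d.choose 2 ∧ q + d.choose 3 = d * m + s ∧ (r ≤ 2 → s = 0) ∧
      (r = 3 → s ≤ 1) ∧
      finrank K (SchurMultiplier π) + m = n.choose 2 + q ∧
      finrank K (ExteriorSquare K L) = n.choose 2 + q ∧
      finrank K (TensorSquare K L) = n * n + q ∧
      finrank K (JTwo K L) + m = n * n + q := by
  obtain ⟨B, hB, ⟨eT⟩, ⟨eE⟩⟩ := exists_square_equivs hDZ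
  obtain ⟨β, hβ⟩ := exists_wedgeCommutator K L
  obtain ⟨eM⟩ := schurMultiplier_equiv π hπ β hβ
  have hfinD : FiniteDimensional K (derivedIdeal K L) :=
    inferInstanceAs (FiniteDimensional K (derivedIdeal K L).toSubmodule)
  have hfinW : FiniteDimensional K (L ⧸ LieAlgebra.center K L) :=
    inferInstanceAs (FiniteDimensional K (L ⧸ (LieAlgebra.center K L).toSubmodule))
  have hfinV : FiniteDimensional K (L ⧸ derivedIdeal K L) :=
    inferInstanceAs (FiniteDimensional K (L ⧸ (derivedIdeal K L).toSubmodule))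
  have hfinT : FiniteDimensional K (TensorSquare K L) := eT.symm.finiteDimensional
  have hfinE : FiniteDimensional K (ExteriorSquare K L) := eE.symm.finiteDimensional
  have hfinM : FiniteDimensional K (SchurMultiplier π) := eM.symm.finiteDimensional
  refine ⟨hfinM, hfinE, hfinT, finrank K B.ker,
    finrank K (((L ⧸ LieAlgebra.center K L) ⊗[K] derivedIdeal K L) ⧸ (jacobiMap B).range),
    finrank K (jacobiMap B).ker, ?_, ?_, ?_, finrank_ker_jacobiMap_le_one B, ?_⟩
  · have h := B.finrank_range_add_finrank_ker
    rw [LinearMap.range_eq_top.2 hB, finrank_top, exteriorPower.finrank_eq, hd, hm] at h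
    rw [← h, add_comm]
  · have h := finrank_coker_jacobiMap B
    rwa [hd, hm] at h
  · intro h
    rw [ker_jacobiMap_eq_bot B h, finrank_bot]
  have hT := eT.finrank_eq
  rw [finrank_prod, finrank_tensorProduct, hn] at hT
  have hE := eE.finrank_eq
  rw [finrank_prod, exteriorPower.finrank_eq, hn] at hE
  refine ⟨?_, hE, hT, ?_⟩
  · have hrange : (β : ExteriorSquare K L →ₗ[K] L).range = (derivedIdeal K L).toSubmodule := by
      rw [← range_of_tensorBilin (f := (β : ExteriorSquare K L →ₗ[K] L) ∘ₗ
        (squareIdeal K L).toSubmodule.mkQ) hβ, LinearMap.range_comp, Submodule.range_mkQ,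
        LinearMap.range_eq_map]
    have h := (β : ExteriorSquare K L →ₗ[K] L).finrank_range_add_finrank_ker
    have hm' : finrank K (derivedIdeal K L).toSubmodule = m := hm
    rw [hrange, hm', hE, ← eM.finrank_eq, add_comm] at h
    exact h
  · have h := (commutatorMap K L : TensorSquare K L →ₗ[K] L).finrank_range_add_finrank_ker
    have hm' : finrank K (derivedIdeal K L).toSubmodule = m := hm
    rw [range_of_tensorBilin (commutatorMap_tensorElt K L), hm', hT, add_comm] at h
    exact h

end Dimensions

theorem mainTheorem5 {𝕜 : Type u} [Field 𝕜] {L : Type v} [LieRing L] [LieAlgebra 𝕜 L]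
    [FiniteDimensional 𝕜 L] (hclass : LieModule.nilpotencyLength L L = 2)
    (d : ℕ) (hd : Module.finrank 𝕜 (L ⧸ LieAlgebra.center 𝕜 L) = d)
    {X : Type w} (π : FreeLieAlgebra 𝕜 X →ₗ⁅𝕜⁆ L) (hπ : Function.Surjective π) :
    (∃ (t : ℕ) (H : LieIdeal 𝕜 L),
      IsGeneralizedHeisenberg 𝕜 H (Module.finrank 𝕜 (derivedIdeal 𝕜 L)) ∧
      Module.finrank 𝕜 (H ⧸ derivedIdeal 𝕜 H) = d ∧
      Nonempty (L ≃ₗ⁅𝕜⁆ H × AbelianLie 𝕜 t)) ∧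
    ∀ (t m : ℕ) (H : Type v) [LieRing H] [LieAlgebra 𝕜 H],
      IsGeneralizedHeisenberg 𝕜 H m → Nonempty (L ≃ₗ⁅𝕜⁆ H × AbelianLie 𝕜 t) →
      ((Module.finrank 𝕜 (derivedIdeal 𝕜 L) : ℚ) = d * (d - 1) / 2 - 1 →
        IsIsoAbelian 𝕜 (SchurMultiplier π)
          (d * (d - 1) * (d + 1) / 3 + (t - 1) * (t + 2 * d) / 2 + 1) ∧
        IsIsoAbelian 𝕜 (ExteriorSquare 𝕜 L)
          ((d - 1) * (2 * d ^ 2 + 5 * d - 6) / 6 + t * (t - 1) / 2 + d * t - 1) ∧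
        IsIsoAbelian 𝕜 (TensorSquare 𝕜 L)
          (d * (d ^ 2 + 3 * d - 4) / 3 + (2 * t ^ 2 + 4 * d * t) / 2) ∧
        IsIsoAbelian 𝕜 (JTwo 𝕜 L)
          (d * (d - 1) * (d + 1) / 3 + (2 * t ^ 2 + 4 * d * t + d ^ 2 - d) / 2 + 1)) ∧
      ((Module.finrank 𝕜 (derivedIdeal 𝕜 L) : ℚ) = d * (d - 1) / 2 - 2 →
        IsIsoAbelian 𝕜 (SchurMultiplier π)
          (d * (d - 1) * (d + 1) / 3 + (t - 1) * (t + 2 * d) / 2 - d + 2) ∧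
        IsIsoAbelian 𝕜 (ExteriorSquare 𝕜 L)
          ((d - 1) * (2 * d ^ 2 + 5 * d - 12) / 6 + t * (t - 1) / 2 + d * t - 2) ∧
        IsIsoAbelian 𝕜 (TensorSquare 𝕜 L)
          (d * (d ^ 2 + 3 * d - 7) / 3 + (2 * t ^ 2 + 4 * d * t) / 2) ∧
        IsIsoAbelian 𝕜 (JTwo 𝕜 L)
          (d * (d - 1) * (d + 1) / 3 + (2 * t ^ 2 + 4 * d * t + d ^ 2 - 3 * d) / 2 + 2)) ∧
      ((Module.finrank 𝕜 (derivedIdeal 𝕜 L) : ℚ) = d * (d - 1) / 2 - 3 →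
        (IsIsoAbelian 𝕜 (SchurMultiplier π)
            (d * (d - 1) * (d + 1) / 3 + (t - 1) * (t + 2 * d) / 2 - 2 * d + 3) ∧
          IsIsoAbelian 𝕜 (ExteriorSquare 𝕜 L)
            ((d - 1) * (2 * d ^ 2 + 5 * d - 18) / 6 + t * (t - 1) / 2 + d * t - 3) ∧
          IsIsoAbelian 𝕜 (TensorSquare 𝕜 L)
            (d * (d ^ 2 + 3 * d - 10) / 3 + (2 * t ^ 2 + 4 * d * t) / 2) ∧
          IsIsoAbelian 𝕜 (JTwo 𝕜 L)
            (d * (d - 1) * (d + 1) / 3 + (2 * t ^ 2 + 4 * d * t + d ^ 2 - 5 * d) / 2 + 3)) ∨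
        (IsIsoAbelian 𝕜 (SchurMultiplier π)
            (d * (d - 1) * (d + 1) / 3 + (t - 1) * (t + 2 * d) / 2 - 2 * d + 4) ∧
          IsIsoAbelian 𝕜 (ExteriorSquare 𝕜 L)
            ((d - 1) * (2 * d ^ 2 + 5 * d - 18) / 6 + t * (t - 1) / 2 + d * t - 2) ∧
          IsIsoAbelian 𝕜 (TensorSquare 𝕜 L)
            (d * (d ^ 2 + 3 * d - 10) / 3 + (2 * t ^ 2 + 4 * d * t) / 2 + 1) ∧
          IsIsoAbelian 𝕜 (JTwo 𝕜 L)
            (d * (d - 1) * (d + 1) / 3 + (2 * t ^ 2 + 4 * d * t + d ^ 2 - 5 * d) / 2 + 4))) := by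
  have hDZ : derivedIdeal 𝕜 L ≤ LieAlgebra.center 𝕜 L := derivedIdeal_le_center hclass
  refine ⟨?_, ?_⟩
  · obtain ⟨t, H, hH, ⟨e⟩⟩ := exists_decomposition hDZ
    obtain ⟨h1, h2, -⟩ := finrank_of_decomposition hH e
    exact ⟨t, H, ⟨hH, h1⟩, h2.trans hd, ⟨e⟩⟩
  · rintro t m H _ _ ⟨hH, -⟩ ⟨e⟩
    obtain ⟨-, -, hn⟩ := finrank_of_decomposition hH e
    rw [hd] at hn
    obtain ⟨hfinM, hfinE, hfinT, r, q, s, hr, hq, hs0, hs1, hM, hE, hT, hJ⟩ :=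
      exists_finrank_formulas hDZ π hπ hd hn rfl
    have hfinJ : FiniteDimensional 𝕜 (JTwo 𝕜 L) :=
      inferInstanceAs (FiniteDimensional 𝕜 (JTwo 𝕜 L).toSubmodule)
    have iM {x : ℚ} (hx : (Module.finrank 𝕜 (SchurMultiplier π) : ℚ) = x) :=
      isIsoAbelian_of_finrank (schurMultiplier_lie_eq_zero π) hx
    have iE {x : ℚ} (hx : (Module.finrank 𝕜 (ExteriorSquare 𝕜 L) : ℚ) = x) :=
      isIsoAbelian_of_finrank (exteriorSquare_lie_eq_zero hDZ) hx
    have iT {x : ℚ} (hx : (Module.finrank 𝕜 (TensorSquare 𝕜 L) : ℚ) = x) :=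
      isIsoAbelian_of_finrank (tensorSquare_lie_eq_zero hDZ) hx
    have iJ {x : ℚ} (hx : (Module.finrank 𝕜 (JTwo 𝕜 L) : ℚ) = x) :=
      isIsoAbelian_of_finrank (M := JTwo 𝕜 L)
        (fun a b => Subtype.ext (tensorSquare_lie_eq_zero hDZ (a : TensorSquare 𝕜 L) b)) hx
    generalize Module.finrank 𝕜 (derivedIdeal 𝕜 L) = l at *
    have hr' : (r : ℚ) = d * (d - 1) / 2 - l := by
      rw [← Nat.cast_choose_two, ← hr]
      push_cast
      ring
    have hq' : (q : ℚ) = d * l + s - d * (d - 1) * (d - 2) / 6 := by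
      rw [← cast_choose_three, eq_sub_iff_add_eq]
      exact_mod_cast hq
    have hM' : (Module.finrank 𝕜 (SchurMultiplier π) : ℚ) = (d + t) * (d + t - 1) / 2 + q - l := by
      have h : (Module.finrank 𝕜 (SchurMultiplier π) : ℚ) + l = (d + t).choose 2 + q := by
        exact_mod_cast hM
      rw [Nat.cast_choose_two] at h
      push_cast at h
      linarith
    have hE' : (Module.finrank 𝕜 (ExteriorSquare 𝕜 L) : ℚ) = (d + t) * (d + t - 1) / 2 + q := by
      rw [hE, Nat.cast_add, Nat.cast_choose_two]
      push_cast
      ring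
    have hT' : (Module.finrank 𝕜 (TensorSquare 𝕜 L) : ℚ) = (d + t) * (d + t) + q := by
      rw [hT]
      push_cast
      ring
    have hJ' : (Module.finrank 𝕜 (JTwo 𝕜 L) : ℚ) = (d + t) * (d + t) + q - l := by
      rw [eq_sub_iff_add_eq]
      exact_mod_cast hJ
    rw [hq'] at hM' hE' hT' hJ'
    refine ⟨fun hl => ?_, fun hl => ?_, fun hl => ?_⟩
    · have hs : s = 0 := hs0 (by
        have : (r : ℚ) = 1 := by rw [hr', hl]; ring
        have : r = 1 := by exact_mod_cast this
        omega)
      subst hs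
      rw [hl] at hM' hE' hT' hJ'
      exact ⟨iM (by rw [hM']; push_cast; ring), iE (by rw [hE']; push_cast; ring),
        iT (by rw [hT']; push_cast; ring), iJ (by rw [hJ']; push_cast; ring)⟩
    · have hs : s = 0 := hs0 (by
        have : (r : ℚ) = 2 := by rw [hr', hl]; ring
        have : r = 2 := by exact_mod_cast this
        omega)
      subst hs
      rw [hl] at hM' hE' hT' hJ'
      exact ⟨iM (by rw [hM']; push_cast; ring), iE (by rw [hE']; push_cast; ring),
        iT (by rw [hT']; push_cast; ring), iJ (by rw [hJ']; push_cast; ring)⟩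
    · have hs : s ≤ 1 := hs1 (by
        have : (r : ℚ) = 3 := by rw [hr', hl]; ring
        exact_mod_cast this)
      rw [hl] at hM' hE' hT' hJ'
      obtain rfl | rfl : s = 0 ∨ s = 1 := by omega
      · exact Or.inl ⟨iM (by rw [hM']; push_cast; ring), iE (by rw [hE']; push_cast; ring),
          iT (by rw [hT']; push_cast; ring), iJ (by rw [hJ']; push_cast; ring)⟩
      · exact Or.inr ⟨iM (by rw [hM']; push_cast; ring), iE (by rw [hE']; push_cast; ring),
          iT (by rw [hT']; push_cast; ring), iJ (by rw [hJ']; push_cast; ring)⟩
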